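/- Let $H_1=E_{11}-E_{22}$, $H_2=E_{22}-E_{33}$ and $E_{ij}$ ($i\neq j$) be the canonical basis of $\mathfrak{sl}(3,\mathbb C)$, let $\mathfrak h$ be the Cartan subalgebra of diagonal traceless matrices, with fundamental weights $\beta_1,\beta_2\in\mathfrak h^*$ (so $\beta_i(H_j)=\delta_{ij}$), and let $\mathscr W$ be the Weyl group, generated by the root reflections of $\mathfrak h^*$. Let $$L=z_{11}H_1+z_{22}H_2+\sum_{i\ne j}z_{ij}E_{ij}$$ be the generic element, with $z_0$, $z_{11}$, $z_{22}$, $z_{ij}$ independent indeterminates over $\mathbb C$, and put $$p=-(z_{11}^2+z_{22}^2-z_{11}z_{22}+z_{12}z_{21}+z_{13}z_{31}+z_{23}z_{32}),\qquad q=\det L .$$ Then $\det(z_0I-L)=z_0^3+pz_0-q$. For a dominant integral weight $\mu=l_1\beta_1+l_2\beta_2$ with $l_1,l_2\in\mathbb N=\{0,1,2,\dots\}$, let $O_\mu$ be its orbit under $\mathscr W$, and define $f_\mu\in\mathbb C[z_0,z_{11},z_{22},z_{ij}]$ as follows. - If $l_1=l_2=0$: $f_\mu=z_0$. - If $l_1\ne0$,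 $l_2=0$: $f_\mu=z_0^3+p\,l_1^2z_0+q\,l_1^3$. - If $l_1=0$, $l_2\neq0$: $f_\mu=z_0^3+p\,l_2^2z_0-q\,l_2^3$. - If $l_1l_2\ne0$: with $N=l_1^2+l_1l_2+l_2^2$ and $K=(l_1-l_2)(2l_1+l_2)(l_1+2l_2)$, $$f_\mu=z_0^6+2pN z_0^4+qK z_0^3+p^2N^2z_0^2+pqKN z_0+q^2N^3+p^3l_1^2l_2^2(l_1+l_2)^2 .$$ (i) Let $\phi:\mathfrak{sl}(3,\mathbb C)\to\mathfrak{gl}(V)$ be a finite-dimensional irreducible representation, so $V=V(\lambda)$, where $\lambda$ is its highest weight. It has finitely many distinct dominant weights $\mu_1,\dots,\mu_s$, and if $m_\lambda(\mu)$ denotes the dimension of the $\mu$-weight space of $V$, then $$\det\Big(z_0I+z_{11}\phi(H_1)+z_{22}\phi(H_2)+\sum_{i\neq j}z_{ij}\phi(E_{ij})\Big)=\prod_{i=1}^s f_{\mu_i}^{\,m_\lambda(\mu_i)} .$$ (ii) For every dominant integral weight $\mu$, the polynomial $f_\mu$ is irreducible in $\mathbb C[z_0,z_{11},z_{22},z_{ij}]$,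 and its total degree and its degree in $z_0$ are both equal to $|O_\mu|\in\{1,3,6\}$. It is obtained from the orbit of $\mu$: whenever the indeterminates take complex values for which $L$ has the same characteristic polynomial as some $D\in\mathfrak h$, the value of $f_\mu$ is $\prod_{\nu\in O_\mu}(z_0+\nu(D))$. -/

import Mathlib

noncomputable section

namespace SL3

open LieAlgebra MvPolynomial

/-- The Lie algebra `sl(3, ℂ)` of traceless complex `3 × 3` matrices. -/
abbrev 𝔤 := SpecialLinear.sl (Fin 3) ℂ

/-- The standard Cartan subalgebra: the diagonal traceless matrices. -/
def 𝔥 : LieSubalgebra ℂ 𝔤 where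
  carrier := {A | ∀ i j, i ≠ j → A.val i j = 0}
  zero_mem' := fun _ _ _ => rfl
  add_mem' := by
    intro A B hA hB i j hij
    have : (A + B).val i j = A.val i j + B.val i j := rfl
    rw [this, hA i j hij, hB i j hij, add_zero]
  smul_mem' := by
    intro c A hA i j hij
    have : (c • A).val i j = c * A.val i j := rfl
    rw [this, hA i j hij, mul_zero]
  lie_mem' := by
    intro A B hA hB i j hij
    rw [SpecialLinear.sl_bracket, Matrix.sub_apply, Matrix.mul_apply, Matrix.mul_apply,
      Finset.sum_eq_zero, Finset.sum_eq_zero, sub_zero]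
    · intro k _
      by_cases h : i = k
      · rw [← h, hA i j hij, mul_zero]
      · rw [hB i k h, zero_mul]
    · intro k _
      by_cases h : i = k
      · rw [← h, hB i j hij, mul_zero]
      · rw [hA i k h, zero_mul]

/-- The `i`-th diagonal entry, as a linear functional on the Cartan subalgebra. -/
def ε (i : Fin 3) : Module.Dual ℂ 𝔥 where
  toFun A := A.val.val i i
  map_add' _ _ := rfl
  map_smul' _ _ := rfl

/-- The coroot `E_{ii} - E_{jj}` of the root `ε_i - ε_j`. -/
def coroot (i j : Fin 3) : 𝔥 :=
  ⟨SpecialLinear.singleSubSingle i j 1, by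
    intro a b hab
    rw [SpecialLinear.val_singleSubSingle, Matrix.sub_apply, Matrix.single_apply_of_ne,
      Matrix.single_apply_of_ne, sub_zero]
    · rintro ⟨rfl, rfl⟩; exact hab rfl
    · rintro ⟨rfl, rfl⟩; exact hab rfl⟩

/-- The root `ε_i - ε_j` (for `i ≠ j`). -/
def root (i j : Fin 3) : Module.Dual ℂ 𝔥 := ε i - ε j

theorem root_coroot (i j : Fin 3) (h : i ≠ j) :
    Module.Dual.eval ℂ 𝔥 (coroot i j) (root i j) = 2 := by
  change ((SpecialLinear.singleSubSingle i j (1 : ℂ)).val i i -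
    (SpecialLinear.singleSubSingle i j (1 : ℂ)).val j j) = 2
  have h' : j ≠ i := h.symm
  simp [h, h']
  norm_num

/-- The reflection `ν ↦ ν - ν(E_{ii} - E_{jj}) (ε_i - ε_j)` of the dual of the Cartan subalgebra. -/
def rootReflection (i j : Fin 3) (h : i ≠ j) : Module.Dual ℂ 𝔥 ≃ₗ[ℂ] Module.Dual ℂ 𝔥 :=
  Module.reflection (root_coroot i j h)

/-- The Weyl group, generated by the reflections in all roots. -/
def weylGroup : Subgroup (Module.Dual ℂ 𝔥 ≃ₗ[ℂ] Module.Dual ℂ 𝔥) :=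
  Subgroup.closure {g | ∃ (i j : Fin 3) (h : i ≠ j), g = rootReflection i j h}

/-- The first fundamental weight `(2 α₁ + α₂) / 3`, where `α₁ = ε₀ - ε₁` and `α₂ = ε₁ - ε₂`
(indices starting at `0`). -/
def β₁ : Module.Dual ℂ 𝔥 := (3⁻¹ : ℂ) • ((2 : ℂ) • root 0 1 + root 1 2)

/-- The second fundamental weight `(α₁ + 2 α₂) / 3`. -/
def β₂ : Module.Dual ℂ 𝔥 := (3⁻¹ : ℂ) • (root 0 1 + (2 : ℂ) • root 1 2)

/-- The dominant integral weight `l₁ β₁ + l₂ β₂`, for a pair `(l₁, l₂)` of natural numbers. -/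
def domWeight (l : ℕ × ℕ) : Module.Dual ℂ 𝔥 := l.1 • β₁ + l.2 • β₂

/-- The orbit of `l₁ β₁ + l₂ β₂` under the Weyl group. -/
def weylOrbit (l : ℕ × ℕ) : Set (Module.Dual ℂ 𝔥) := MulAction.orbit weylGroup (domWeight l)

section Representation

variable (V : Type*) [AddCommGroup V] [Module ℂ V] [LieRingModule 𝔤 V] [LieModule ℂ 𝔤 V]

/-- The multiplicity in `V` of a weight `ν`: the dimension of its weight space
`{v | ∀ A ∈ 𝔥, A v = ν(A) v}`. -/
def multiplicity (ν : Module.Dual ℂ 𝔥) : ℕ :=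
  Module.finrank ℂ (LieModule.weightSpace (L := 𝔥) V ν)

/-- The pairs `(l₁, l₂)` of natural numbers for which `l₁ β₁ + l₂ β₂` is a weight of `V`. -/
def dominantWeights : Set (ℕ × ℕ) :=
  {l | LieModule.weightSpace (L := 𝔥) V (domWeight l) ≠ ⊥}

end Representation

/-- Index set of the canonical basis: `H₁`, `H₂` (left) and `E_{ij}` with `i ≠ j` (right). -/
abbrev BasisIndex := Fin 2 ⊕ {ij : Fin 3 × Fin 3 // ij.1 ≠ ij.2}

/-- The canonical basis of `sl(3, ℂ)`: `H₁ = E₁₁ - E₂₂`, `H₂ = E₂₂ - E₃₃` and `E_{ij}`, `i ≠ j`. -/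
def stdBasis : BasisIndex → 𝔤
  | .inl 0 => SpecialLinear.singleSubSingle 0 1 1
  | .inl 1 => SpecialLinear.singleSubSingle 1 2 1
  | .inr ij => SpecialLinear.single ij.val.1 ij.val.2 ij.property 1

/-- The ring of complex polynomials in the nine indeterminates `z₀` (index `none`) and `z_k`,
where `k` runs through the index set of the canonical basis. -/
abbrev PolyRing := MvPolynomial (Option BasisIndex) ℂ

/-- The indeterminate `z₀`. -/
def z₀ : PolyRing := X none

/-- The indeterminate `z_{ii}`, the coefficient of `H_i`. -/
def zH (i : Fin 2) : PolyRing := X (some (.inl i))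

/-- The indeterminate `z_{ij}`, the coefficient of `E_{ij}`. -/
def zE (i j : Fin 3) (h : i ≠ j := by decide) : PolyRing := X (some (.inr ⟨(i, j), h⟩))

/-- The generic element `L = z₁₁ H₁ + z₂₂ H₂ + ∑ z_{ij} E_{ij}` of `sl(3, ℂ)`. -/
def genericL : Matrix (Fin 3) (Fin 3) PolyRing :=
  ∑ k : BasisIndex, (X (some k) : PolyRing) • (stdBasis k).val.map C

/-- The element `z₁₁ H₁ + z₂₂ H₂ + ∑ z_{ij} E_{ij}` of `sl(3, ℂ)` for complex numbers `z`. -/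
def specialL (z : Option BasisIndex → ℂ) : 𝔤 := ∑ k : BasisIndex, z (some k) • stdBasis k

/-- The polynomial `det (z₀ I + ∑ z_k φ(x_k))`, where `φ` is the representation of `sl(3, ℂ)` on `V`,
`x_k` runs through the canonical basis, and the endomorphisms are written as matrices in a basis
of `V`. -/
def charPoly {V : Type*} [AddCommGroup V] [Module ℂ V] [LieRingModule 𝔤 V] [LieModule ℂ 𝔤 V]
    {ι : Type*} [Fintype ι] [DecidableEq ι] (b : Module.Basis ι ℂ V) : PolyRing :=
  Matrix.det (z₀ • (1 : Matrix ι ι PolyRing) +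
    ∑ k : BasisIndex, (X (some k) : PolyRing) •
      (LinearMap.toMatrix b b (LieModule.toEnd ℂ 𝔤 V (stdBasis k))).map C)

/-- The coefficient `p` of `z₀` in `det (z₀ I - L)`, written out. -/
def p : PolyRing :=
  -(zH 0 ^ 2 + zH 1 ^ 2 - zH 0 * zH 1 + zE 0 1 * zE 1 0 + zE 0 2 * zE 2 0 + zE 1 2 * zE 2 1)

/-- `q = det L`. -/
def q : PolyRing := genericL.det

/-- The factor `f_μ` for `μ = l₁ β₁ + l₂ β₂`, as an explicit polynomial in `z₀`, `p` and `q`. -/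
def orbitalFactor (l : ℕ × ℕ) : PolyRing :=
  let l₁ : PolyRing := (l.1 : PolyRing)
  let l₂ : PolyRing := (l.2 : PolyRing)
  if l.1 = 0 ∧ l.2 = 0 then z₀
  else if l.2 = 0 then z₀ ^ 3 + p * l₁ ^ 2 * z₀ + q * l₁ ^ 3
  else if l.1 = 0 then z₀ ^ 3 + p * l₂ ^ 2 * z₀ - q * l₂ ^ 3
  else
    z₀ ^ 6
    + 2 * p * (l₁ ^ 2 + l₁ * l₂ + l₂ ^ 2) * z₀ ^ 4
    + q * (l₁ - l₂) * (2 * l₁ + l₂) * (l₁ + 2 * l₂) * z₀ ^ 3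
    + p ^ 2 * (l₁ ^ 2 + l₁ * l₂ + l₂ ^ 2) ^ 2 * z₀ ^ 2
    + p * q * (l₁ - l₂) * (2 * l₁ + l₂) * (l₁ + 2 * l₂) * (l₁ ^ 2 + l₁ * l₂ + l₂ ^ 2) * z₀
    + (q ^ 2 * (l₁ ^ 2 + l₁ * l₂ + l₂ ^ 2) ^ 3 + p ^ 3 * (l₁ ^ 2 * l₂ ^ 2 * (l₁ + l₂) ^ 2))

end SL3

end

/-!
The factorization is an identity between polynomials, so it suffices to check it at the complex
values of the indeterminates for which the discriminant `-4 p³ - 27 q²` of the characteristic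
polynomial of `L` is nonzero (`charPoly_eq_prod`). There `L = P D P⁻¹` with `D` in the Cartan
subalgebra (`exists_diagonalization`).

Conjugation by a suitable `P` lifts to every finite-dimensional representation `V`: for a
transvection `1 + c E_{ij}` the lift is the exponential of the nilpotent action of `c E_{ij}`
(`lifts_transvection`), and transvections generate all invertible matrices up to diagonal ones,
which commute with `D` (`exists_lifts_mul_diagonal`). Hence the determinant for `L` equals the one
for `D`. As `V` is irreducible, the sum of its weight spaces, a nonzero submodule, is all of `V`
(`iSup_weightSubmodule`), so the determinant for `D` is the product of the numbers
`(z₀ + ν(D)) ^ m(ν)` over all weights `ν`. Lifts of permutation matrices show that multiplicities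
are constant on Weyl group orbits (`multiplicity_orbitWeight`); by `sl₂`-theory weights are integral
(`exists_int_coroot`), hence conjugate to dominant ones, so the product can be grouped by orbits of
dominant weights (`det_smul_one_add_cartan_eq_prod_orbits`).

On the Cartan subalgebra `β₁ = ε₀` and `β₂ = -ε₂`, so the orbit of `l₁ β₁ + l₂ β₂` consists of the
weights `l₁ ε_i - l₂ ε_j` with `i ≠ j` (`mem_weylOrbit_iff`), and expanding the product over the
orbit in the eigenvalues of `D` gives the explicit factor (`eval_orbitalFactor`).

A factor is monic in `z₀`, so it is irreducible once some specialization of the other variables is.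
Specializing `L` to a matrix with `p = 1` and `q` an indeterminate yields a polynomial over `ℂ[z₀]`
which is linear in `q`, or quadratic in `q` with a discriminant that is not a square
(`irreducible_sexticFactor`).
-/

namespace SL3

noncomputable section

open MvPolynomial LieAlgebra

/-! ### The generic traceless matrix -/

theorem sum_offDiagonal {M : Type*} [AddCommMonoid M]
    (f : {ij : Fin 3 × Fin 3 // ij.1 ≠ ij.2} → M) :
    ∑ ij, f ij = f ⟨(0, 1), by decide⟩ + f ⟨(0, 2), by decide⟩ + f ⟨(1, 0), by decide⟩ +
      f ⟨(1, 2), by decide⟩ + f ⟨(2, 0), by decide⟩ + f ⟨(2, 1), by decide⟩ := by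
  have huniv : (Finset.univ : Finset {ij : Fin 3 × Fin 3 // ij.1 ≠ ij.2}) =
      {⟨(0, 1), by decide⟩, ⟨(0, 2), by decide⟩, ⟨(1, 0), by decide⟩, ⟨(1, 2), by decide⟩,
        ⟨(2, 0), by decide⟩, ⟨(2, 1), by decide⟩} := by decide
  rw [huniv]
  simp [add_assoc]

theorem map_C_single (i j : Fin 3) (x : PolyRing) :
    x • (Matrix.single i j (1 : ℂ)).map (C : ℂ → PolyRing) = Matrix.single i j x := by
  rw [Matrix.map_single _ _ _ C, Matrix.smul_single]
  simp

theorem sum_single_eq {R : Type*} [CommRing R] (a b c d e f g h : R) :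
    Matrix.single 0 0 a - Matrix.single 1 1 a + (Matrix.single 1 1 b - Matrix.single 2 2 b) +
      (Matrix.single 0 1 c + Matrix.single 0 2 d + Matrix.single 1 0 e + Matrix.single 1 2 f +
        Matrix.single 2 0 g + Matrix.single 2 1 h) =
      (!![a, c, d; e, b - a, f; g, h, -b] : Matrix (Fin 3) (Fin 3) R) := by
  refine Matrix.ext fun i j => ?_
  fin_cases i <;> fin_cases j <;> simp
  ring

theorem genericL_eq : genericL =
    !![zH 0, zE 0 1, zE 0 2; zE 1 0, zH 1 - zH 0, zE 1 2; zE 2 0, zE 2 1, -zH 1] := by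
  have hzH (i : Fin 2) : X (some (.inl i)) = zH i := rfl
  have hzE (ij : {ij : Fin 3 × Fin 3 // ij.1 ≠ ij.2}) :
      X (some (.inr ij)) = zE ij.val.1 ij.val.2 ij.property := rfl
  rw [genericL, Fintype.sum_sum_type, sum_offDiagonal, Fin.sum_univ_two]
  simp only [stdBasis, hzH, hzE, SpecialLinear.val_single, SpecialLinear.val_singleSubSingle,
    Matrix.map_sub C (map_sub C), smul_sub, map_C_single]
  exact sum_single_eq _ _ _ _ _ _ _ _

theorem specialL_eq (z : Option BasisIndex → ℂ) :
    (specialL z).val = genericL.map (eval z) := by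
  ext i j
  simp only [specialL, genericL, Matrix.map_apply, Matrix.sum_apply, Matrix.smul_apply, map_sum,
    smul_eq_mul, map_mul, eval_X, eval_C]
  rw [AddSubmonoidClass.coe_finsetSum, Matrix.sum_apply]
  rfl

theorem q_eq : q = zH 0 * ((zH 1 - zH 0) * -zH 1 - zE 1 2 * zE 2 1)
    - zE 0 1 * (zE 1 0 * -zH 1 - zE 1 2 * zE 2 0)
    + zE 0 2 * (zE 1 0 * zE 2 1 - (zH 1 - zH 0) * zE 2 0) := by
  rw [q, genericL_eq, Matrix.det_fin_three]
  simp
  ring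

theorem det_sub_genericL :
    Matrix.det (z₀ • (1 : Matrix (Fin 3) (Fin 3) PolyRing) - genericL) =
      z₀ ^ 3 + p * z₀ - q := by
  rw [q_eq, genericL_eq, p, Matrix.det_fin_three]
  simp
  ring

/-- The identity of `det_sub_genericL` at complex values of the indeterminates. -/
theorem charpoly_specialL (z : Option BasisIndex → ℂ) (t : ℂ) :
    (specialL z).val.charpoly.eval t = t ^ 3 + eval z p * t - eval z q := by
  rw [Matrix.eval_charpoly, specialL_eq, q_eq, p, Matrix.det_fin_three, genericL_eq]
  simp
  ring

/-! ### Degrees of the factors -/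

theorem isHomogeneous_zH (i : Fin 2) : (zH i).IsHomogeneous 1 := isHomogeneous_X _ _

theorem isHomogeneous_zE (i j : Fin 3) (h : i ≠ j) : (zE i j h).IsHomogeneous 1 :=
  isHomogeneous_X _ _

theorem isHomogeneous_p : p.IsHomogeneous 2 := by
  have hH (i j) : (zH i * zH j).IsHomogeneous 2 := (isHomogeneous_zH i).mul (isHomogeneous_zH j)
  have hE (i j k l h h') : (zE i j h * zE k l h').IsHomogeneous 2 :=
    (isHomogeneous_zE i j h).mul (isHomogeneous_zE k l h')
  rw [p, sq, sq]
  exact ((((((hH 0 0).add (hH 1 1)).sub (hH 0 1)).add (hE _ _ _ _ _ _)).add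
    (hE _ _ _ _ _ _)).add (hE _ _ _ _ _ _)).neg

theorem isHomogeneous_q : q.IsHomogeneous 3 := by
  have hH := isHomogeneous_zH
  have hE := isHomogeneous_zE
  rw [q_eq]
  exact (((hH 0).mul ((((hH 1).sub (hH 0)).mul (hH 1).neg).sub ((hE _ _ _).mul (hE _ _ _)))).sub
    ((hE _ _ _).mul (((hE _ _ _).mul (hH 1).neg).sub ((hE _ _ _).mul (hE _ _ _))))).add
    ((hE _ _ _).mul (((hE _ _ _).mul (hE _ _ _)).sub (((hH 1).sub (hH 0)).mul (hE _ _ _))))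

/-- The polynomials `p` and `q` do not involve `z₀`. -/
theorem exists_optionEquivLeft_p_q : ∃ P Q : MvPolynomial BasisIndex ℂ,
    optionEquivLeft ℂ BasisIndex p = Polynomial.C P ∧
      optionEquivLeft ℂ BasisIndex q = Polynomial.C Q := by
  have hH (i : Fin 2) : optionEquivLeft ℂ BasisIndex (zH i) = Polynomial.C (X (.inl i)) :=
    optionEquivLeft_X_some _ _ _
  have hE (i j : Fin 3) (h : i ≠ j) : optionEquivLeft ℂ BasisIndex (zE i j h) =
      Polynomial.C (X (.inr ⟨(i, j), h⟩)) := optionEquivLeft_X_some _ _ _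
  rw [q_eq, p]
  simp only [map_add, map_sub, map_mul, map_neg, map_pow, hH, hE]
  simp only [← map_add, ← map_sub, ← map_mul, ← map_neg, ← map_pow]
  exact ⟨_, _, rfl, rfl⟩

/-- The `z₀`-degree is read off after viewing the polynomial as one in `z₀` alone. -/
theorem degreeOf_eq_of_isHomogeneous {f : PolyRing} {n : ℕ}
    (hn : (optionEquivLeft ℂ BasisIndex f).natDegree = n) (hf : f.IsHomogeneous n) (h0 : f ≠ 0) :
    f.totalDegree = n ∧ f.degreeOf none = n :=
  ⟨hf.totalDegree h0, by rw [← hn, natDegree_optionEquivLeft]⟩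

/-- The common shape `z₀³ + a p z₀ + b q` of the factors of degree three. -/
def cubicFactor (a b : ℂ) : PolyRing := z₀ ^ 3 + C a * p * z₀ + C b * q

/-- The common shape of the factors of degree six; it is a quadratic polynomial in `q`. -/
def sexticFactor (N K M : ℂ) : PolyRing :=
  z₀ ^ 6 + C (2 * N) * p * z₀ ^ 4 + C K * q * z₀ ^ 3 + C (N ^ 2) * p ^ 2 * z₀ ^ 2 +
    C (K * N) * p * q * z₀ + (C (N ^ 3) * q ^ 2 + C M * p ^ 3)

theorem isHomogeneous_cubicFactor (a b : ℂ) : (cubicFactor a b).IsHomogeneous 3 := by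
  have hz : z₀.IsHomogeneous 1 := isHomogeneous_X _ _
  exact ((hz.pow 3).add (((isHomogeneous_p.C_mul a).mul hz))).add (isHomogeneous_q.C_mul b)

theorem isHomogeneous_sexticFactor (N K M : ℂ) : (sexticFactor N K M).IsHomogeneous 6 := by
  have hz : z₀.IsHomogeneous 1 := isHomogeneous_X _ _
  have hp := isHomogeneous_p
  have hq := isHomogeneous_q
  exact (((((hz.pow 6).add ((hp.C_mul _).mul (hz.pow 4))).add ((hq.C_mul _).mul (hz.pow 3))).add
    (((hp.pow 2).C_mul _).mul (hz.pow 2))).add (((hp.C_mul _).mul hq).mul hz)).add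
    (((hq.pow 2).C_mul _).add ((hp.pow 3).C_mul _))

theorem monic_cubicFactor (a b : ℂ) :
    (optionEquivLeft ℂ BasisIndex (cubicFactor a b)).Monic ∧
      (optionEquivLeft ℂ BasisIndex (cubicFactor a b)).natDegree = 3 := by
  obtain ⟨P, Q, hP, hQ⟩ := exists_optionEquivLeft_p_q
  have h : optionEquivLeft ℂ BasisIndex (cubicFactor a b) = Polynomial.X ^ 3 +
      Polynomial.C (C a * P) * Polynomial.X + Polynomial.C (C b * Q) := by
    simp [cubicFactor, hP, hQ, z₀, optionEquivLeft_X_none, optionEquivLeft_C]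
  rw [h]
  exact ⟨by monicity!, by compute_degree!⟩

theorem monic_sexticFactor (N K M : ℂ) :
    (optionEquivLeft ℂ BasisIndex (sexticFactor N K M)).Monic ∧
      (optionEquivLeft ℂ BasisIndex (sexticFactor N K M)).natDegree = 6 := by
  obtain ⟨P, Q, hP, hQ⟩ := exists_optionEquivLeft_p_q
  have h : optionEquivLeft ℂ BasisIndex (sexticFactor N K M) = Polynomial.X ^ 6 +
      Polynomial.C (C (2 * N) * P) * Polynomial.X ^ 4 +
      Polynomial.C (C K * Q) * Polynomial.X ^ 3 +
      Polynomial.C (C (N ^ 2) * P ^ 2) * Polynomial.X ^ 2 +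
      Polynomial.C (C (K * N) * P * Q) * Polynomial.X +
      Polynomial.C (C (N ^ 3) * Q ^ 2 + C M * P ^ 3) := by
    simp only [sexticFactor, hP, hQ, z₀, optionEquivLeft_X_none, optionEquivLeft_C, map_add,
      map_mul, map_pow]
  rw [h]
  exact ⟨by monicity!, by compute_degree!⟩

/-! ### Irreducibility of the factors -/

/-- The specialization of `L` to the matrix with rows `(0, 1, 0)`, `(-1, 0, 1)`, `(t, 0, 0)`, for
which `p = 1` and `q = t`. -/
def companionCoeff : BasisIndex → Polynomial ℂ
  | .inl _ => 0
  | .inr ij => if ij.val = (0, 1) then 1 else if ij.val = (1, 2) then 1 else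
      if ij.val = (1, 0) then -1 else if ij.val = (2, 0) then Polynomial.X else 0

/-- Substitution of `companionCoeff` in a polynomial; the result is a polynomial in `q` whose
coefficients are polynomials in `z₀`. -/
def companionEval : PolyRing →ₐ[ℂ] Polynomial (Polynomial ℂ) :=
  aeval fun k => k.elim (Polynomial.C Polynomial.X) fun k => (companionCoeff k).map Polynomial.C

theorem companionEval_p : companionEval p = 1 := by
  simp [companionEval, p, zH, zE, companionCoeff]

theorem companionEval_q : companionEval q = Polynomial.X := by
  simp [companionEval, q_eq, zH, zE, companionCoeff]

theorem companionEval_z₀ : companionEval z₀ = Polynomial.C Polynomial.X := by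
  simp [companionEval, z₀]

theorem companionEval_C (a : ℂ) : companionEval (C a) = Polynomial.C (Polynomial.C a) := by
  simp [companionEval]

/-- A polynomial which is monic in `z₀` is irreducible as soon as its specialization is. -/
theorem irreducible_of_companionEval {f : PolyRing}
    (hm : (optionEquivLeft ℂ BasisIndex f).Monic) (h : Irreducible (companionEval f)) :
    Irreducible f := by
  have key : companionEval f = Polynomial.Bivariate.swap
      ((optionEquivLeft ℂ BasisIndex f).map (aeval companionCoeff).toRingHom) := by
    have : companionEval = (Polynomial.Bivariate.swap (R := ℂ)).toAlgHom.comp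
        ((Polynomial.mapAlgHom (aeval companionCoeff)).comp
          (optionEquivLeft ℂ BasisIndex).toAlgHom) := by
      refine MvPolynomial.algHom_ext fun k => ?_
      cases k with
      | none =>
        simp [companionEval, optionEquivLeft_X_none, Polynomial.Bivariate.swap_Y]
      | some k =>
        simp [companionEval, optionEquivLeft_X_some, Polynomial.Bivariate.swap_C]
    exact DFunLike.congr_fun this f
  rw [key, MulEquiv.irreducible_iff] at h
  exact (MulEquiv.irreducible_iff (optionEquivLeft ℂ BasisIndex)).1
    (Polynomial.Monic.irreducible_of_irreducible_map _ _ hm h)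

/-- The specialized factor is linear in `q`, with the constant leading coefficient `b`. -/
theorem irreducible_cubicFactor {a b : ℂ} (hb : b ≠ 0) : Irreducible (cubicFactor a b) := by
  refine irreducible_of_companionEval (monic_cubicFactor a b).1 ?_
  have hu : IsUnit (Polynomial.C (Polynomial.C b⁻¹)) :=
    Polynomial.isUnit_C.2 (Polynomial.isUnit_C.2 (inv_ne_zero hb).isUnit)
  rw [← irreducible_isUnit_mul hu]
  have : Polynomial.C (Polynomial.C b⁻¹) * companionEval (cubicFactor a b) = Polynomial.X -
      Polynomial.C (-(Polynomial.C b⁻¹ * (Polynomial.X ^ 3 + Polynomial.C a * Polynomial.X))) := by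
    have hb' : (Polynomial.C (Polynomial.C b⁻¹) * Polynomial.C (Polynomial.C b) :
        Polynomial (Polynomial ℂ)) = 1 := by
      rw [← map_mul, ← map_mul, inv_mul_cancel₀ hb, map_one, map_one]
    simp only [cubicFactor, map_add, map_mul, map_pow, map_neg, companionEval_p, companionEval_q,
      companionEval_z₀, companionEval_C]
    linear_combination Polynomial.X * hb'
  rw [this]
  exact Polynomial.irreducible_X_sub_C _

/-- The key point is that, up to a nonzero constant, the discriminant of the factor with respect
to `q` at `p = 1` is `(z² + N / 3)² (z² + 4 N / 3)`, which is not a square. -/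
theorem irreducible_sexticFactor {N K M : ℂ} (hN : N ≠ 0) (hM : M ≠ 0)
    (h : K ^ 2 - 4 * N ^ 3 = -27 * M) : Irreducible (sexticFactor N K M) := by
  refine irreducible_of_companionEval (monic_sexticFactor N K M).1 ?_
  set c : ℂ := (N ^ 3)⁻¹ with hc
  have hcN : c * N ^ 3 = 1 := inv_mul_cancel₀ (pow_ne_zero 3 hN)
  have hu : IsUnit (Polynomial.C (Polynomial.C c)) :=
    Polynomial.isUnit_C.2 (Polynomial.isUnit_C.2 (inv_ne_zero (pow_ne_zero 3 hN)).isUnit)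
  rw [← irreducible_isUnit_mul hu]
  set w : Polynomial ℂ := Polynomial.X ^ 3 + Polynomial.C N * Polynomial.X with hw
  have hf : Polynomial.C (Polynomial.C c) * companionEval (sexticFactor N K M) =
      Polynomial.X ^ 2 + Polynomial.C (Polynomial.C (c * K) * w) * Polynomial.X +
        Polynomial.C (Polynomial.C c * (w ^ 2 + Polynomial.C M)) := by
    have hb' : (Polynomial.C (Polynomial.C c) * Polynomial.C (Polynomial.C N) ^ 3 :
        Polynomial (Polynomial ℂ)) = 1 := by
      rw [← map_pow, ← map_pow, ← map_mul, ← map_mul, hcN, map_one, map_one]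
    simp only [sexticFactor, map_add, map_mul, map_pow, companionEval_p, companionEval_q,
      companionEval_z₀, companionEval_C, hw, map_ofNat]
    linear_combination Polynomial.X ^ 2 * hb'
  have hdeg : (Polynomial.X ^ 2 + Polynomial.C (Polynomial.C (c * K) * w) * Polynomial.X +
        Polynomial.C (Polynomial.C c * (w ^ 2 + Polynomial.C M))).natDegree = 2 := by
    compute_degree!
  rw [hf, Polynomial.Monic.irreducible_iff_roots_eq_zero_of_degree_le_three (by monicity!)
    hdeg.ge (hdeg.le.trans (by norm_num)), Multiset.eq_zero_iff_forall_notMem]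
  intro r hr
  have hr := Polynomial.isRoot_of_mem_roots hr
  simp only [Polynomial.IsRoot, Polynomial.eval_add, Polynomial.eval_mul, Polynomial.eval_pow,
    Polynomial.eval_X, Polynomial.eval_C] at hr
  -- A root `r` of the quadratic over `ℂ[z]` makes the discriminant the square of `s` below.
  have hroot (x : ℂ) : (r.eval x) ^ 2 + c * K * (x ^ 3 + N * x) * r.eval x +
      c * ((x ^ 3 + N * x) ^ 2 + M) = 0 := by
    have := congrArg (Polynomial.eval x) hr
    simpa [hw] using this
  obtain ⟨a, ha⟩ := IsAlgClosed.exists_pow_nat_eq (-4 * N / 3) (n := 2) (by norm_num)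
  set s : Polynomial ℂ := Polynomial.C (2 * N ^ 3) * r + Polynomial.C K * w with hs
  have hsq : s ^ 2 = Polynomial.C (-27 * M) * ((Polynomial.X ^ 2 + Polynomial.C (N / 3)) ^ 2 *
      (Polynomial.X ^ 2 + Polynomial.C (4 * N / 3))) := by
    refine Polynomial.funext fun x => ?_
    simp only [hs, hw, Polynomial.eval_pow, Polynomial.eval_add, Polynomial.eval_mul,
      Polynomial.eval_C, Polynomial.eval_X]
    linear_combination (4 * N ^ 6) * hroot x + ((x ^ 3 + N * x) ^ 2) * h -
      4 * N ^ 3 * (K * (x ^ 3 + N * x) * r.eval x + (x ^ 3 + N * x) ^ 2 + M) * hcN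
  -- `a` is a simple zero of `z² + 4 N / 3` and not one of `z² + N / 3`, so it is a simple zero of
  -- the right-hand side of `hsq`, whereas every zero of `s ^ 2` is multiple.
  have h0 : s.eval a = 0 := by
    have := congrArg (Polynomial.eval a) hsq
    simp only [Polynomial.eval_pow, Polynomial.eval_mul, Polynomial.eval_add, Polynomial.eval_X,
      Polynomial.eval_C, ha] at this
    exact pow_eq_zero_iff (two_ne_zero) |>.1 (this.trans (by ring))
  have h1 := congrArg (fun f => Polynomial.eval a (Polynomial.derivative f)) hsq
  simp [Polynomial.derivative_pow, h0] at h1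
  have ha0 : a ≠ 0 := by
    rintro rfl
    apply hN
    linear_combination (3 / 4 : ℂ) * ha
  rcases h1 with h1 | h1
  · exact hM h1
  · rw [ha] at h1
    have : N ^ 2 * a = 0 := by linear_combination (1 / 2 : ℂ) * h1
    exact mul_ne_zero (pow_ne_zero 2 hN) ha0 this

/-! ### Weyl group orbits -/

theorem ε_apply (i : Fin 3) (D : 𝔥) : ε i D = D.val.val i i := rfl

theorem trace_cartan (D : 𝔥) : D.val.val 0 0 + D.val.val 1 1 + D.val.val 2 2 = 0 := by
  have h : Matrix.trace D.val.val = 0 := D.val.property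
  rwa [Matrix.trace_fin_three] at h

theorem cartan_eq_diagonal (D : 𝔥) : D.val.val = Matrix.diagonal fun i => D.val.val i i := by
  ext i j
  by_cases h : i = j
  · subst h; simp
  · rw [Matrix.diagonal_apply_ne _ h]
    exact D.property i j h

theorem ε_coroot (k i j : Fin 3) : ε k (coroot i j) =
    (((if k = i then 1 else 0) - (if k = j then 1 else 0) : ℤ) : ℂ) := by
  change Matrix.single i i (1 : ℂ) k k - Matrix.single j j (1 : ℂ) k k = _
  simp [Matrix.single_apply, eq_comm]

/-- The weight `l₁ ε_i - l₂ ε_j`; for `i ≠ j` these are the members of the orbit of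
`l₁ β₁ + l₂ β₂`. -/
def orbitWeight (l : ℕ × ℕ) (i j : Fin 3) : Module.Dual ℂ 𝔥 := l.1 • ε i - l.2 • ε j

theorem orbitWeight_apply (l : ℕ × ℕ) (i j : Fin 3) (D : 𝔥) :
    orbitWeight l i j D = l.1 * D.val.val i i - l.2 * D.val.val j j := by
  simp [orbitWeight, ε_apply]

/-- On traceless diagonal matrices `β₁ = ε₀` and `β₂ = -ε₂`. -/
theorem domWeight_eq (l : ℕ × ℕ) : domWeight l = orbitWeight l 0 2 := by
  ext D
  have h := trace_cartan D
  rw [orbitWeight_apply]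
  simp only [domWeight, β₁, β₂, root, LinearMap.add_apply, LinearMap.smul_apply,
    LinearMap.sub_apply, ε_apply, nsmul_eq_mul, smul_eq_mul]
  linear_combination ((l.1 : ℂ) / 3 - l.2 / 3 : ℂ) * (-1) * h

/-- The coefficient `ν(E_{aa} - E_{bb})` of the orbit member `ν = l₁ ε_i - l₂ ε_j`. -/
def orbitPairing (l : ℕ × ℕ) (i j a b : Fin 3) : ℤ :=
  l.1 * ((if i = a then 1 else 0) - (if i = b then 1 else 0)) -
    l.2 * ((if j = a then 1 else 0) - (if j = b then 1 else 0))

theorem orbitWeight_coroot (l : ℕ × ℕ) (i j a b : Fin 3) :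
    orbitWeight l i j (coroot a b) = (orbitPairing l i j a b : ℂ) := by
  simp only [orbitWeight, LinearMap.sub_apply, LinearMap.smul_apply, ε_coroot, orbitPairing,
    nsmul_eq_mul]
  push_cast
  ring

theorem orbitPairing_congr {l l' : ℕ × ℕ} {i j i' j' : Fin 3}
    (h : orbitWeight l i j = orbitWeight l' i' j') (a b : Fin 3) :
    orbitPairing l i j a b = orbitPairing l' i' j' a b := by
  have := congrArg (fun ν : Module.Dual ℂ 𝔥 => ν (coroot a b)) h
  simp only [orbitWeight_coroot] at this
  exact_mod_cast this

/-- A Weyl group orbit contains only one dominant weight. -/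
theorem eq_of_domWeight_eq_orbitWeight {l l' : ℕ × ℕ} {i j : Fin 3} (hij : i ≠ j)
    (h : domWeight l' = orbitWeight l i j) : l' = l := by
  rw [domWeight_eq] at h
  have h1 := orbitPairing_congr h 0 1
  have h2 := orbitPairing_congr h 1 2
  obtain ⟨m, n⟩ := l
  obtain ⟨m', n'⟩ := l'
  simp only [orbitPairing] at h1 h2
  rw [Prod.mk.injEq]
  fin_cases i <;> fin_cases j <;> simp at hij h1 h2 <;> omega

theorem rootReflection_ε (i j : Fin 3) (h : i ≠ j) (k : Fin 3) :
    rootReflection i j h (ε k) = ε (Equiv.swap i j k) := by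
  have h1 : rootReflection i j h (ε k) = ε k - ε k (coroot i j) • root i j := by
    simp [rootReflection, Module.reflection_apply]
  rw [h1, ε_coroot, root]
  by_cases hi : k = i
  · subst hi; simp [h]
  · by_cases hj : k = j
    · subst hj; simp [Ne.symm h]
    · rw [Equiv.swap_apply_of_ne_of_ne hi hj]; simp [hi, hj]

theorem exists_perm_of_mem_weylGroup {g : Module.Dual ℂ 𝔥 ≃ₗ[ℂ] Module.Dual ℂ 𝔥}
    (hg : g ∈ weylGroup) : ∃ σ : Equiv.Perm (Fin 3), ∀ k, g (ε k) = ε (σ k) := by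
  induction hg using Subgroup.closure_induction with
  | mem g hg =>
    obtain ⟨i, j, h, rfl⟩ := hg
    exact ⟨Equiv.swap i j, rootReflection_ε i j h⟩
  | one => exact ⟨1, fun k => rfl⟩
  | mul g g' _ _ h h' =>
    obtain ⟨σ, hσ⟩ := h
    obtain ⟨τ, hτ⟩ := h'
    exact ⟨σ * τ, fun k => by rw [LinearEquiv.mul_apply, hτ, hσ]; rfl⟩
  | inv g _ h =>
    obtain ⟨σ, hσ⟩ := h
    refine ⟨σ⁻¹, fun k => ?_⟩
    have : g (ε (σ⁻¹ k)) = ε k := by rw [hσ]; simp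
    rw [← this]
    exact LinearEquiv.symm_apply_apply g _

theorem exists_mem_weylGroup (σ : Equiv.Perm (Fin 3)) :
    ∃ g ∈ weylGroup, ∀ k, g (ε k) = ε (σ k) := by
  induction σ using Equiv.Perm.swap_induction_on with
  | one => exact ⟨1, one_mem _, fun k => rfl⟩
  | swap_mul τ i j hij h =>
    obtain ⟨g, hg, hgk⟩ := h
    refine ⟨rootReflection i j hij * g,
      mul_mem (Subgroup.subset_closure ⟨i, j, hij, rfl⟩) hg, fun k => ?_⟩
    rw [LinearEquiv.mul_apply, hgk, rootReflection_ε]; rfl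

theorem mem_weylOrbit_iff {l : ℕ × ℕ} {ν : Module.Dual ℂ 𝔥} :
    ν ∈ weylOrbit l ↔ ∃ i j, i ≠ j ∧ ν = orbitWeight l i j := by
  constructor
  · rintro ⟨⟨g, hg⟩, rfl⟩
    obtain ⟨σ, hσ⟩ := exists_perm_of_mem_weylGroup hg
    refine ⟨σ 0, σ 2, fun h => by simpa using σ.injective h, ?_⟩
    change g (domWeight l) = _
    rw [domWeight_eq, orbitWeight, orbitWeight, map_sub, map_nsmul, map_nsmul, hσ, hσ]
  · rintro ⟨i, j, hij, rfl⟩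
    obtain ⟨σ, rfl, rfl⟩ : ∃ σ : Equiv.Perm (Fin 3), σ 0 = i ∧ σ 2 = j := by
      revert i j; decide
    obtain ⟨g, hg, hgk⟩ := exists_mem_weylGroup σ
    refine ⟨⟨g, hg⟩, ?_⟩
    change g (domWeight l) = _
    rw [domWeight_eq, orbitWeight, orbitWeight, map_sub, map_nsmul, map_nsmul, hgk, hgk]

theorem weylOrbit_zero : weylOrbit (0, 0) = Set.range fun _ : Unit => (0 : Module.Dual ℂ 𝔥) := by
  ext ν
  rw [mem_weylOrbit_iff]
  simp only [orbitWeight, zero_smul, sub_zero, Set.mem_range, exists_const]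
  exact ⟨fun ⟨_, _, _, h⟩ => h.symm, fun h => ⟨0, 1, by decide, h.symm⟩⟩

/-- When `l₂ = 0` the second index of `orbitWeight` does not matter; it is taken equal to the
first. -/
theorem weylOrbit_fst (m : ℕ) : weylOrbit (m, 0) = Set.range fun i => orbitWeight (m, 0) i i := by
  ext ν
  rw [mem_weylOrbit_iff]
  simp only [orbitWeight, zero_smul, sub_zero, Set.mem_range]
  exact ⟨fun ⟨i, _, _, h⟩ => ⟨i, h.symm⟩, fun ⟨i, h⟩ => ⟨i, i + 1, by simp, h.symm⟩⟩

theorem weylOrbit_snd (n : ℕ) : weylOrbit (0, n) = Set.range fun i => orbitWeight (0, n) i i := by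
  ext ν
  rw [mem_weylOrbit_iff]
  simp only [orbitWeight, zero_smul, zero_sub, Set.mem_range]
  exact ⟨fun ⟨_, i, _, h⟩ => ⟨i, h.symm⟩, fun ⟨i, h⟩ => ⟨i + 1, i, by simp, h.symm⟩⟩

/-- The six pairs of distinct indices are enumerated as `(i, i + 1)` and `(i, i + 2)`. -/
theorem weylOrbit_range (l : ℕ × ℕ) : weylOrbit l =
    Set.range fun x : Fin 3 × Fin 2 => orbitWeight l x.1 (x.1 + x.2.castSucc + 1) := by
  ext ν
  rw [mem_weylOrbit_iff]
  constructor
  · rintro ⟨i, j, hij, rfl⟩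
    obtain ⟨k, hk⟩ : ∃ k : Fin 2, i + k.castSucc + 1 = j := by
      revert i j; decide
    exact ⟨(i, k), by rw [← hk]⟩
  · rintro ⟨⟨i, k⟩, rfl⟩
    exact ⟨i, _, by revert i k; decide, rfl⟩

theorem injective_orbitWeight_diag {l : ℕ × ℕ} (h : l.1 ≠ l.2) :
    Function.Injective fun i => orbitWeight l i i := by
  intro i i' hii
  have h1 := orbitPairing_congr hii 0 1
  have h2 := orbitPairing_congr hii 1 2
  simp only [orbitPairing] at h1 h2
  fin_cases i <;> fin_cases i' <;> simp at h1 h2 ⊢ <;> omega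

theorem injective_orbitWeight {l : ℕ × ℕ} (h1 : l.1 ≠ 0) (h2 : l.2 ≠ 0) :
    Function.Injective fun x : Fin 3 × Fin 2 =>
      orbitWeight l x.1 (x.1 + x.2.castSucc + 1) := by
  rintro ⟨i, k⟩ ⟨i', k'⟩ hii
  have h1 := orbitPairing_congr hii 0 1
  have h2 := orbitPairing_congr hii 1 2
  simp only [orbitPairing] at h1 h2
  fin_cases i <;> fin_cases k <;> fin_cases i' <;> fin_cases k' <;>
    simp at h1 h2 ⊢ <;> omega

theorem weylOrbit_finite (l : ℕ × ℕ) : (weylOrbit l).Finite := by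
  rw [weylOrbit_range]
  exact Set.finite_range _

/-! ### Comparison of the factors with the orbits -/

theorem orbitalFactor_zero : orbitalFactor (0, 0) = z₀ := by
  simp [orbitalFactor]

theorem orbitalFactor_fst {m : ℕ} (hm : m ≠ 0) :
    orbitalFactor (m, 0) = cubicFactor (m ^ 2) (m ^ 3) := by
  simp [orbitalFactor, hm, cubicFactor]
  ring

theorem orbitalFactor_snd {n : ℕ} (hn : n ≠ 0) :
    orbitalFactor (0, n) = cubicFactor (n ^ 2) (-n ^ 3) := by
  simp [orbitalFactor, hn, cubicFactor]
  ring

theorem orbitalFactor_of_ne_zero {m n : ℕ} (hm : m ≠ 0) (hn : n ≠ 0) :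
    orbitalFactor (m, n) = sexticFactor (m ^ 2 + m * n + n ^ 2)
      ((m - n) * (2 * m + n) * (m + 2 * n)) (m ^ 2 * n ^ 2 * (m + n) ^ 2) := by
  simp only [orbitalFactor, hm, hn, sexticFactor, false_and, if_false, map_add, map_mul, map_sub,
    map_pow, map_natCast, map_ofNat]
  ring

theorem eval_orbitalFactor (l : ℕ × ℕ) (z : Option BasisIndex → ℂ) (D : 𝔥)
    (h : (specialL z).val.charpoly = D.val.val.charpoly) :
    eval z (orbitalFactor l) = ∏ᶠ ν ∈ weylOrbit l, (z none + ν D) := by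
  have hchar (t : ℂ) : t ^ 3 + eval z p * t - eval z q =
      (t - D.val.val 0 0) * (t - D.val.val 1 1) * (t - D.val.val 2 2) := by
    rw [← charpoly_specialL, h, cartan_eq_diagonal D, Matrix.charpoly_diagonal, Fin.prod_univ_three]
    simp
  obtain ⟨m, n⟩ := l
  have htr := trace_cartan D
  have hq : eval z q = D.val.val 0 0 * D.val.val 1 1 * D.val.val 2 2 := by
    linear_combination -hchar 0
  have hp : eval z p = D.val.val 0 0 * D.val.val 1 1 + D.val.val 1 1 * D.val.val 2 2 +
      D.val.val 0 0 * D.val.val 2 2 := by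
    linear_combination hchar 1 - hchar 0 - htr
  have hz : eval z z₀ = z none := by simp [z₀]
  rcases Nat.eq_zero_or_pos m with rfl | hm <;> rcases Nat.eq_zero_or_pos n with rfl | hn
  · rw [weylOrbit_zero, finprod_mem_range (fun _ _ _ => rfl), finprod_eq_prod_of_fintype,
      orbitalFactor_zero]
    simp [hz]
  · rw [weylOrbit_snd, finprod_mem_range (injective_orbitWeight_diag hn.ne),
      finprod_eq_prod_of_fintype, orbitalFactor_snd hn.ne', cubicFactor]
    simp only [map_add, map_mul, map_pow, eval_C, hz, hp, hq, Fin.prod_univ_three,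
      orbitWeight_apply]
    generalize D.val.val 0 0 = a, D.val.val 1 1 = b, D.val.val 2 2 = c at *
    obtain rfl : c = -a - b := by linear_combination htr
    push_cast
    ring
  · rw [weylOrbit_fst, finprod_mem_range (injective_orbitWeight_diag hm.ne'),
      finprod_eq_prod_of_fintype, orbitalFactor_fst hm.ne', cubicFactor]
    simp only [map_add, map_mul, map_pow, eval_C, hz, hp, hq, Fin.prod_univ_three,
      orbitWeight_apply]
    generalize D.val.val 0 0 = a, D.val.val 1 1 = b, D.val.val 2 2 = c at *
    obtain rfl : c = -a - b := by linear_combination htr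
    push_cast
    ring
  · rw [weylOrbit_range, finprod_mem_range (injective_orbitWeight hm.ne' hn.ne'),
      finprod_eq_prod_of_fintype, orbitalFactor_of_ne_zero hm.ne' hn.ne', sexticFactor,
      Fintype.prod_prod_type]
    simp only [map_add, map_mul, map_pow, eval_C, hz, hp, hq, Fin.prod_univ_three,
      Fin.prod_univ_two, orbitWeight_apply]
    simp
    generalize D.val.val 0 0 = a, D.val.val 1 1 = b, D.val.val 2 2 = c at *
    obtain rfl : c = -a - b := by linear_combination htr
    ring

theorem ncard_weylOrbit_fst {m : ℕ} (hm : m ≠ 0) : (weylOrbit (m, 0)).ncard = 3 := by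
  rw [weylOrbit_fst, Set.ncard_range_of_injective (injective_orbitWeight_diag hm)]
  simp

theorem ncard_weylOrbit_snd {n : ℕ} (hn : n ≠ 0) : (weylOrbit (0, n)).ncard = 3 := by
  rw [weylOrbit_snd, Set.ncard_range_of_injective (injective_orbitWeight_diag hn.symm)]
  simp

theorem ncard_weylOrbit_of_ne_zero {m n : ℕ} (hm : m ≠ 0) (hn : n ≠ 0) :
    (weylOrbit (m, n)).ncard = 6 := by
  rw [weylOrbit_range, Set.ncard_range_of_injective (injective_orbitWeight hm hn)]
  simp

theorem orbitalFactor_properties (l : ℕ × ℕ) : Irreducible (orbitalFactor l) ∧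
    (orbitalFactor l).totalDegree = (weylOrbit l).ncard ∧
    (orbitalFactor l).degreeOf none = (weylOrbit l).ncard ∧
    (weylOrbit l).ncard ∈ ({1, 3, 6} : Set ℕ) := by
  obtain ⟨m, n⟩ := l
  rcases eq_or_ne m 0 with rfl | hm <;> rcases eq_or_ne n 0 with rfl | hn
  · have h1 : (weylOrbit (0, 0)).ncard = 1 := by
      rw [weylOrbit_zero, Set.range_const, Set.ncard_singleton]
    rw [h1, orbitalFactor_zero, z₀]
    exact ⟨X_prime.irreducible, totalDegree_X _, by simp, by simp⟩
  · have hirr : Irreducible (cubicFactor (n ^ 2) (-n ^ 3)) := irreducible_cubicFactor (by simp [hn])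
    rw [ncard_weylOrbit_snd hn, orbitalFactor_snd hn]
    obtain ⟨h1, h2⟩ := degreeOf_eq_of_isHomogeneous (monic_cubicFactor _ _).2
      (isHomogeneous_cubicFactor _ _) hirr.ne_zero
    exact ⟨hirr, h1, h2, by simp⟩
  · have hirr : Irreducible (cubicFactor (m ^ 2) (m ^ 3)) := irreducible_cubicFactor (by simp [hm])
    rw [ncard_weylOrbit_fst hm, orbitalFactor_fst hm]
    obtain ⟨h1, h2⟩ := degreeOf_eq_of_isHomogeneous (monic_cubicFactor _ _).2
      (isHomogeneous_cubicFactor _ _) hirr.ne_zero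
    exact ⟨hirr, h1, h2, by simp⟩
  · have hN : (m ^ 2 + m * n + n ^ 2 : ℂ) ≠ 0 := by
      have : m ^ 2 + m * n + n ^ 2 ≠ 0 := by positivity
      exact_mod_cast this
    have hM : (m ^ 2 * n ^ 2 * (m + n) ^ 2 : ℂ) ≠ 0 := by
      have : m ^ 2 * n ^ 2 * (m + n) ^ 2 ≠ 0 := by positivity
      exact_mod_cast this
    have hirr := irreducible_sexticFactor (K := (m - n) * (2 * m + n) * (m + 2 * n)) hN hM (by ring)
    rw [ncard_weylOrbit_of_ne_zero hm hn, orbitalFactor_of_ne_zero hm hn]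
    obtain ⟨h1, h2⟩ := degreeOf_eq_of_isHomogeneous (monic_sexticFactor _ _ _).2
      (isHomogeneous_sexticFactor _ _ _) hirr.ne_zero
    exact ⟨hirr, h1, h2, by simp⟩

/-! ### Exponentials of nilpotent elements -/

open IsNilpotent TensorProduct in
/-- The exponential of a nilpotent element `x` intertwines the action of a Lie algebra with the
action twisted by the automorphism `exp (ad x)`. -/
theorem exp_toEnd_lie {L M : Type*} [LieRing L] [LieAlgebra ℂ L] [AddCommGroup M] [Module ℂ M]
    [LieRingModule L M] [LieModule ℂ L M] [Module ℚ L] [Module ℚ M] {x : L}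
    (hL : IsNilpotent (LieModule.toEnd ℂ L L x)) (hM : IsNilpotent (LieModule.toEnd ℂ L M x))
    (y : L) (v : M) :
    exp (LieModule.toEnd ℂ L M x) ⁅y, v⁆ =
      ⁅exp (LieModule.toEnd ℂ L L x) y, exp (LieModule.toEnd ℂ L M x) v⁆ := by
  set e := LieModule.toEnd ℂ L M x
  set d := LieModule.toEnd ℂ L L x
  let eT : Module.End ℂ (L ⊗[ℂ] M) := e.lTensor L
  let dT : Module.End ℂ (L ⊗[ℂ] M) := d.rTensor M
  have he : IsNilpotent eT := hM.map <| Module.End.lTensorAlgHom ℂ M L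
  have hd : IsNilpotent dT := hL.map <| Module.End.rTensorAlgHom ℂ L M
  have hc : Commute dT eT := by ext; simp [dT, eT]
  let m : L ⊗[ℂ] M →ₗ[ℂ] M := (LieModule.toModuleHom ℂ L M : L ⊗[ℂ] M →ₗ[ℂ] M)
  have hm (y : L) (v : M) : m (y ⊗ₜ v) = ⁅y, v⁆ := LieModule.toModuleHom_apply ℂ L M y v
  have h1 : exp e ∘ₗ m = m ∘ₗ exp (dT + eT) := by
    apply Module.End.commute_exp_left_of_commute (hc.isNilpotent_add hd he) hM
    ext y v
    simp [dT, eT, hm, e, d]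
  have h2 : exp eT = (exp e).lTensor L := (hM.map_exp (Module.End.lTensorAlgHom ℂ M L)).symm
  have h3 : exp dT = (exp d).rTensor M := (hL.map_exp (Module.End.rTensorAlgHom ℂ L M)).symm
  have := LinearMap.congr_fun h1 (y ⊗ₜ v)
  rw [exp_add_of_commute hc hd he, h2, h3] at this
  simpa [hm] using this

/-- An element `e` of a Lie algebra for which there is `h` with `[h, e] = 2 e` acts nilpotently on
every finite-dimensional module: the nonzero powers of `e` are eigenvectors of `ad h` for distinct
eigenvalues. -/
theorem isNilpotent_toEnd_of_lie_eq_two_smul {L M : Type*} [LieRing L] [LieAlgebra ℂ L]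
    [AddCommGroup M] [Module ℂ M] [LieRingModule L M] [LieModule ℂ L M] [FiniteDimensional ℂ M]
    {h e : L} (he : ⁅h, e⁆ = (2 : ℂ) • e) : IsNilpotent (LieModule.toEnd ℂ L M e) := by
  set E := LieModule.toEnd ℂ L M e with hE
  set H := LieModule.toEnd ℂ L M h with hH
  have hHE : H * E - E * H = (2 : ℂ) • E := by
    ext v
    change ⁅h, ⁅e, v⁆⁆ - ⁅e, ⁅h, v⁆⁆ = (2 : ℂ) • ⁅e, v⁆
    rw [← lie_lie, he, smul_lie]
  have hpow (n : ℕ) : H * E ^ n - E ^ n * H = (2 * n : ℂ) • E ^ n := by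
    induction n with
    | zero => simp
    | succ n ih =>
      have : H * E ^ (n + 1) - E ^ (n + 1) * H =
          (H * E ^ n - E ^ n * H) * E + E ^ n * (H * E - E * H) := by
        rw [pow_succ]; noncomm_ring
      rw [this, ih, hHE, pow_succ, smul_mul_assoc, mul_smul_comm, ← add_smul]
      congr 1
      push_cast
      ring
  by_contra hnil
  have hne (n : ℕ) : E ^ n ≠ 0 := fun h0 => hnil ⟨n, h0⟩
  let A : Module.End ℂ (Module.End ℂ M) := LinearMap.mulLeft ℂ H - LinearMap.mulRight ℂ H
  have hev (n : ℕ) : A.HasEigenvalue (2 * n) :=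
    Module.End.hasEigenvalue_of_hasEigenvector
      ⟨Module.End.mem_eigenspace_iff.2 (hpow n), hne n⟩
  have hinj : Function.Injective fun n : ℕ => (2 * n : ℂ) := fun a b hab => by simpa using hab
  exact Set.infinite_range_of_injective hinj
    (A.finite_hasEigenvalue.subset (Set.range_subset_iff.2 hev))

/-! ### Lifting conjugations to a representation -/

theorem isSl2Triple (i j : Fin 3) (h : i ≠ j) :
    IsSl2Triple (SpecialLinear.singleSubSingle i j (1 : ℂ)) (SpecialLinear.single i j h 1)
      (SpecialLinear.single j i h.symm 1) where
  h_ne_zero := by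
    intro h0
    have := congrArg (fun A : 𝔤 => A.val i i) h0
    simp [h.symm] at this
  lie_e_f := by
    apply Subtype.ext
    rw [SpecialLinear.sl_bracket]
    simp
  lie_h_e_nsmul := by
    apply Subtype.ext
    rw [SpecialLinear.sl_bracket]
    simp [sub_mul, mul_sub, h.symm, two_smul, ← Matrix.single_add]
  lie_h_f_nsmul := by
    apply Subtype.ext
    rw [SpecialLinear.sl_bracket]
    simp [sub_mul, mul_sub, h, two_smul]
    abel

section Lift

variable (V : Type*) [AddCommGroup V] [Module ℂ V] [LieRingModule 𝔤 V]

/-- The invertible matrix `P` lifts to `V` if there is an automorphism of the vector space `V`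
which intertwines the action of `x` with the action of `P x P⁻¹`. The latter element `y` is
described by `y P = P x`. -/
def Lifts (P : Matrix (Fin 3) (Fin 3) ℂ) : Prop :=
  IsUnit P ∧ ∃ A : V ≃ₗ[ℂ] V, ∀ x y : 𝔤, y.val * P = P * x.val → ∀ v, ⁅y, A v⁆ = A ⁅x, v⁆

variable {V}

theorem Lifts.mul {P Q : Matrix (Fin 3) (Fin 3) ℂ} (hP : Lifts V P) (hQ : Lifts V Q) :
    Lifts V (P * Q) := by
  obtain ⟨⟨P, rfl⟩, A, hA⟩ := hP
  obtain ⟨hQ, B, hB⟩ := hQ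
  refine ⟨P.isUnit.mul hQ, B.trans A, fun x y hxy v => ?_⟩
  let w : 𝔤 := ⟨(↑P⁻¹ : Matrix (Fin 3) (Fin 3) ℂ) * y.val * P.val, by
    have hy : Matrix.trace y.val = 0 := y.property
    change Matrix.trace ((↑P⁻¹ : Matrix (Fin 3) (Fin 3) ℂ) * y.val * P.val) = 0
    rw [mul_assoc, Matrix.trace_mul_comm, mul_assoc, P.mul_inv, mul_one, hy]⟩
  have h1 : y.val * P = P * w.val := by
    simp only [w, ← mul_assoc, P.mul_inv, one_mul]
  have h2 : w.val * Q = Q * x.val := by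
    simp only [w]
    rw [mul_assoc, mul_assoc, hxy, mul_assoc, ← mul_assoc, P.inv_mul, one_mul]
  rw [LinearEquiv.trans_apply, hA w y h1, hB x w h2, LinearEquiv.trans_apply]

theorem lifts_one : Lifts V 1 := by
  refine ⟨isUnit_one, LinearEquiv.refl ℂ V, fun x y h v => ?_⟩
  rw [mul_one, one_mul] at h
  rw [Subtype.ext h]; rfl

variable [LieModule ℂ 𝔤 V]

variable (V) in
theorem isNilpotent_toEnd_single [FiniteDimensional ℂ V] (i j : Fin 3) (h : i ≠ j) (c : ℂ) :
    IsNilpotent (LieModule.toEnd ℂ 𝔤 V (SpecialLinear.single i j h c)) := by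
  refine isNilpotent_toEnd_of_lie_eq_two_smul (h := SpecialLinear.singleSubSingle i j (1 : ℂ)) ?_
  have hc : SpecialLinear.single i j h c = c • SpecialLinear.single i j h (1 : ℂ) := by
    rw [← map_smul, smul_eq_mul, mul_one]
  rw [hc, lie_smul, (isSl2Triple i j h).lie_h_e_smul ℂ, smul_comm]

theorem lifts_transvection [FiniteDimensional ℂ V] (i j : Fin 3) (h : i ≠ j) (c : ℂ) :
    Lifts V (Matrix.transvection i j c) := by
  let _ : Module ℚ V := Module.compHom V (algebraMap ℚ ℂ)
  let _ : Module ℚ 𝔤 := Module.compHom 𝔤 (algebraMap ℚ ℂ)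
  set E : 𝔤 := SpecialLinear.single i j h c with hE
  have hEE : E.val * E.val = 0 := by
    rw [hE, SpecialLinear.val_single, Matrix.single_mul_single_of_ne _ _ _ _ h.symm]
  have hT : Matrix.transvection i j c = 1 + E.val := rfl
  have hTu : (1 + E.val) * (1 - E.val) = 1 := by
    rw [add_mul, mul_sub, mul_sub, hEE]; simp
  have hu : IsUnit (Matrix.transvection i j c) := by
    rw [hT]; exact IsUnit.of_mul_eq_one _ hTu
  have hV : IsNilpotent (LieModule.toEnd ℂ 𝔤 V E) := isNilpotent_toEnd_single V i j h c
  set d := LieModule.toEnd ℂ 𝔤 𝔤 E with hd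
  have hd1 (x : 𝔤) : (d x).val = E.val * x.val - x.val * E.val := SpecialLinear.sl_bracket _ _ _ _
  -- Since `E ^ 2 = 0`, one has `(ad E) ^ 3 = 0` and
  -- `(1 + E) x (1 - E) = x + [E, x] + [E, [E, x]] / 2`.
  have hd2 (x : 𝔤) : (d (d x)).val = (-2 : ℂ) • (E.val * x.val * E.val) := by
    rw [hd1, hd1, mul_sub, sub_mul, ← mul_assoc, hEE, mul_assoc x.val, hEE, ← mul_assoc, zero_mul,
      mul_zero, zero_sub, sub_zero, neg_smul, two_smul]
    abel
  have hd3 : d ^ 3 = 0 := by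
    ext1 x
    apply Subtype.ext
    change (d (d (d x))).val = 0
    rw [hd1, hd2, mul_smul_comm, smul_mul_assoc, mul_assoc _ E.val E.val, hEE, ← mul_assoc,
      ← mul_assoc, hEE]
    simp
  have hexp (x : 𝔤) : (IsNilpotent.exp d x).val * (1 + E.val) = (1 + E.val) * x.val := by
    have h3 : (IsNilpotent.exp d x) = x + d x + (2⁻¹ : ℂ) • d (d x) := by
      rw [IsNilpotent.exp_eq_sum hd3]
      simp [Finset.sum_range_succ, pow_two]
      change (algebraMap ℚ ℂ 2⁻¹) • d (d x) = _
      simp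
    rw [h3]
    change (x.val + (d x).val + (2⁻¹ : ℂ) • (d (d x)).val) * _ = _
    rw [hd1, hd2, smul_smul]
    simp only [add_mul, mul_add, sub_mul, mul_one, one_mul, smul_mul_assoc, mul_assoc, hEE,
      mul_zero, smul_zero]
    norm_num
    abel
  refine ⟨hu, LinearEquiv.ofBijective (IsNilpotent.exp (LieModule.toEnd ℂ 𝔤 V E))
    ((Module.End.isUnit_iff _).1 (IsNilpotent.isUnit_exp hV)), fun x y hxy v => ?_⟩
  have hy : y = IsNilpotent.exp d x := by
    apply Subtype.ext
    rw [hT] at hxy hu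
    exact hu.mul_left_injective (hxy.trans (hexp x).symm)
  rw [LinearEquiv.ofBijective_apply, LinearEquiv.ofBijective_apply,
    exp_toEnd_lie ⟨3, hd3⟩ hV, hy]

/-- Every invertible matrix lifts to `V` after multiplication with an invertible diagonal matrix.
The second diagonal factor makes the statement stable under products. -/
theorem exists_lifts_mul_diagonal [FiniteDimensional ℂ V] (P : Matrix (Fin 3) (Fin 3) ℂ)
    (hP : P.det ≠ 0) (d : Fin 3 → ℂˣ) : ∃ e : Fin 3 → ℂˣ,
      Lifts V (Matrix.diagonal (fun i => (d i : ℂ)) * P * Matrix.diagonal fun i => (e i : ℂ)) := by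
  refine Matrix.diagonal_transvection_induction_of_det_ne_zero (fun P => ∀ d : Fin 3 → ℂˣ,
    ∃ e : Fin 3 → ℂˣ, Lifts V (Matrix.diagonal (fun i => (d i : ℂ)) * P *
      Matrix.diagonal fun i => (e i : ℂ))) P hP (fun D hD d => ?_) (fun t d => ?_)
    (fun A B hA hB ihA ihB d => ?_) d
  · rw [Matrix.det_diagonal, Finset.prod_ne_zero_iff] at hD
    refine ⟨fun i => (d i * Units.mk0 (D i) (hD i (Finset.mem_univ i)))⁻¹, ?_⟩
    rw [Matrix.diagonal_mul_diagonal, Matrix.diagonal_mul_diagonal]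
    convert lifts_one (V := V)
    rw [← Matrix.diagonal_one]
    congr 1
    ext i
    have := hD i (Finset.mem_univ i)
    simp
    field_simp
  · obtain ⟨i, j, hij, c⟩ := t
    refine ⟨fun i => (d i)⁻¹, ?_⟩
    convert lifts_transvection (V := V) i j hij (d i * c * (d j)⁻¹)
    ext a b
    rw [Matrix.mul_diagonal, Matrix.diagonal_mul]
    simp only [Matrix.TransvectionStruct.toMatrix, Matrix.transvection, Matrix.add_apply,
      Matrix.single_apply, Matrix.one_apply]
    by_cases hab : a = b
    · subst hab
      have : ¬ (i = a ∧ j = a) := by rintro ⟨rfl, rfl⟩; exact hij rfl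
      simp [this]
    · by_cases h : i = a ∧ j = b
      · obtain ⟨rfl, rfl⟩ := h
        simp [hab]
      · simp [hab, h]
  · obtain ⟨e, he⟩ := ihA d
    obtain ⟨f, hf⟩ := ihB fun i => (e i)⁻¹
    refine ⟨f, ?_⟩
    convert he.mul hf using 1
    have : (Matrix.diagonal fun i => (e i : ℂ)) * (Matrix.diagonal fun i => ((e i)⁻¹ : ℂˣ).val) =
        1 := by
      rw [Matrix.diagonal_mul_diagonal]; simp
    simp only [mul_assoc]
    rw [← mul_assoc (Matrix.diagonal fun i => (e i : ℂ)), this, one_mul]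

/-- The lift of a conjugation which transforms one element of the Cartan subalgebra. -/
theorem exists_equiv_of_det_ne_zero [FiniteDimensional ℂ V] (P : Matrix (Fin 3) (Fin 3) ℂ)
    (hP : P.det ≠ 0) : ∃ A : V ≃ₗ[ℂ] V, ∀ (D : 𝔥) (y : 𝔤), y.val * P = P * D.val.val →
      ∀ v, ⁅y, A v⁆ = A ⁅D.val, v⁆ := by
  obtain ⟨e, -, A, hA⟩ := exists_lifts_mul_diagonal (V := V) P hP 1
  refine ⟨A, fun D y h => hA _ _ ?_⟩
  have hD : (Matrix.diagonal fun i => ((e i : ℂˣ) : ℂ)) * D.val.val =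
      D.val.val * Matrix.diagonal fun i => (e i : ℂ) := by
    rw [cartan_eq_diagonal D, Matrix.diagonal_mul_diagonal, Matrix.diagonal_mul_diagonal]
    simp only [mul_comm]
  simp only [Pi.one_apply, Units.val_one, Matrix.diagonal_one, one_mul]
  rw [mul_assoc, hD, ← mul_assoc, ← mul_assoc, h]

end Lift

/-! ### Weight spaces -/

instance isLieAbelian_cartan : IsLieAbelian 𝔥 where
  trivial D D' := by
    apply Subtype.ext
    apply Subtype.ext
    change D.val.val * D'.val.val - D'.val.val * D.val.val = 0
    rw [cartan_eq_diagonal D, cartan_eq_diagonal D', Matrix.diagonal_mul_diagonal,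
      Matrix.diagonal_mul_diagonal]
    simp only [mul_comm, sub_self]

theorem val_coroot (i j : Fin 3) :
    (coroot i j).val.val = Matrix.single i i 1 - Matrix.single j j 1 := rfl

theorem lie_cartan_single (D : 𝔥) (i j : Fin 3) (h : i ≠ j) (c : ℂ) :
    ⁅D.val, SpecialLinear.single i j h c⁆ = root i j D • SpecialLinear.single i j h c := by
  apply Subtype.ext
  change D.val.val * Matrix.single i j c - Matrix.single i j c * D.val.val =
    root i j D • Matrix.single i j c
  rw [cartan_eq_diagonal D]
  ext a b
  rw [Matrix.sub_apply, Matrix.diagonal_mul, Matrix.mul_diagonal, Matrix.smul_apply]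
  by_cases hab : i = a ∧ j = b
  · obtain ⟨rfl, rfl⟩ := hab
    simp [root, ε_apply]
    ring
  · rw [Matrix.single_apply, if_neg hab]
    simp

/-- The root space decomposition of `sl(3, ℂ)`. -/
theorem exists_cartan_add_single (x : 𝔤) : ∃ (D : 𝔥) (c : {ij : Fin 3 × Fin 3 // ij.1 ≠ ij.2} → ℂ),
    x = D.val + ∑ ij, SpecialLinear.single ij.val.1 ij.val.2 ij.property (c ij) := by
  let c : {ij : Fin 3 × Fin 3 // ij.1 ≠ ij.2} → ℂ := fun ij => x.val ij.val.1 ij.val.2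
  let S : 𝔤 := ∑ ij, SpecialLinear.single ij.val.1 ij.val.2 ij.property (c ij)
  have hS : S.val = Matrix.single 0 1 (x.val 0 1) + Matrix.single 0 2 (x.val 0 2) +
      Matrix.single 1 0 (x.val 1 0) + Matrix.single 1 2 (x.val 1 2) +
      Matrix.single 2 0 (x.val 2 0) + Matrix.single 2 1 (x.val 2 1) := by
    simp only [S]
    rw [sum_offDiagonal]
    rfl
  refine ⟨⟨x - S, fun i j hij => ?_⟩, c, (sub_add_cancel x S).symm⟩
  change x.val i j - S.val i j = 0
  rw [hS]
  fin_cases i <;> fin_cases j <;> simp at hij ⊢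

section Weights

variable (V : Type*) [AddCommGroup V] [Module ℂ V] [LieRingModule 𝔤 V] [LieModule ℂ 𝔤 V]

/-- The weight space of `V` for the weight `ν`, as a vector subspace. -/
def weightSubmodule (ν : Module.Dual ℂ 𝔥) : Submodule ℂ V :=
  (LieModule.weightSpace (L := 𝔥) V ν).toSubmodule

variable {V}

theorem mem_weightSubmodule {ν : Module.Dual ℂ 𝔥} {v : V} :
    v ∈ weightSubmodule V ν ↔ ∀ D : 𝔥, ⁅D.val, v⁆ = ν D • v :=
  LieModule.mem_weightSpace (L := 𝔥) (M := V) ν v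

theorem multiplicity_eq (ν : Module.Dual ℂ 𝔥) :
    multiplicity V ν = Module.finrank ℂ (weightSubmodule V ν) := rfl

theorem mem_dominantWeights {l : ℕ × ℕ} :
    l ∈ dominantWeights V ↔ weightSubmodule V (domWeight l) ≠ ⊥ := by
  rw [weightSubmodule, ne_eq, LieSubmodule.toSubmodule_eq_bot]; rfl

theorem lie_single_mem {ν : Module.Dual ℂ 𝔥} {v : V} (hv : v ∈ weightSubmodule V ν) (i j : Fin 3)
    (h : i ≠ j) (c : ℂ) :
    ⁅SpecialLinear.single i j h c, v⁆ ∈ weightSubmodule V (ν + root i j) := by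
  rw [mem_weightSubmodule] at hv ⊢
  intro D
  rw [leibniz_lie, lie_cartan_single, hv, lie_smul, smul_lie, LinearMap.add_apply, add_smul,
    add_comm]

variable (V)

theorem iSupIndep_weightSubmodule : iSupIndep (weightSubmodule V) := by
  have h1 : iSupIndep fun ν : Module.Dual ℂ 𝔥 =>
      (LieModule.genWeightSpace V (ν : 𝔥 → ℂ)).toSubmodule :=
    (LieSubmodule.iSupIndep_toSubmodule.2 (LieModule.iSupIndep_genWeightSpace ℂ 𝔥 V)).comp
      DFunLike.coe_injective
  exact h1.mono fun ν => LieModule.weightSpace_le_genWeightSpace V ν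

/-- The sum of the weight spaces of an irreducible representation is a nonzero submodule. -/
theorem iSup_weightSubmodule [FiniteDimensional ℂ V] [LieModule.IsIrreducible ℂ 𝔤 V] :
    ⨆ ν, weightSubmodule V ν = ⊤ := by
  have hle (ν) : weightSubmodule V ν ≤ ⨆ ν, weightSubmodule V ν := le_iSup _ ν
  let N : LieSubmodule ℂ 𝔤 V :=
    { (⨆ ν, weightSubmodule V ν : Submodule ℂ V) with
      lie_mem := by
        intro x v hv
        change v ∈ ⨆ ν, weightSubmodule V ν at hv
        change ⁅x, v⁆ ∈ ⨆ ν, weightSubmodule V ν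
        induction hv using Submodule.iSup_induction' with
        | mem ν v hv =>
          obtain ⟨D, c, rfl⟩ := exists_cartan_add_single x
          rw [add_lie, sum_lie]
          refine add_mem ?_ (Submodule.sum_mem _ fun ij _ => hle _ (lie_single_mem hv _ _ _ _))
          rw [mem_weightSubmodule.1 hv D]
          exact Submodule.smul_mem _ _ (hle ν hv)
        | zero => rw [lie_zero]; exact zero_mem _
        | add v w _ _ hv hw => rw [lie_add]; exact add_mem hv hw }
  have : Nontrivial V := (LieSubmodule.nontrivial_iff ℂ 𝔤 V).1 inferInstance
  obtain ⟨χ, hχ⟩ := LieModule.exists_nontrivial_weightSpace_of_isNilpotent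
    (k := ℂ) (L := 𝔥) (M := V)
  obtain ⟨⟨v, hv⟩, hv0⟩ := exists_ne (0 : LieModule.weightSpace (L := 𝔥) V χ)
  have hvN : v ∈ N := hle χ hv
  have : Nontrivial N := ⟨⟨v, hvN⟩, 0, fun h =>
    hv0 (Subtype.ext (show v = 0 from congrArg Subtype.val h))⟩
  have := LieSubmodule.eq_top_of_isIrreducible ℂ 𝔤 V N
  exact congrArg LieSubmodule.toSubmodule this

theorem finite_weights [FiniteDimensional ℂ V] : {ν | weightSubmodule V ν ≠ ⊥}.Finite :=
  WellFoundedGT.finite_ne_bot_of_iSupIndep (iSupIndep_weightSubmodule V)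

variable {V}

/-- The weights are integral: raise a weight vector to a primitive vector for the `sl₂`-triple of
the root. -/
theorem exists_int_coroot [FiniteDimensional ℂ V] {ν : Module.Dual ℂ 𝔥}
    (hν : weightSubmodule V ν ≠ ⊥) (i j : Fin 3) (h : i ≠ j) :
    ∃ n : ℤ, ν (coroot i j) = n := by
  obtain ⟨v, hv, hv0⟩ := Submodule.exists_mem_ne_zero_of_ne_bot hν
  have t := isSl2Triple i j h
  have hh : ⁅SpecialLinear.singleSubSingle i j (1 : ℂ), v⁆ = ν (coroot i j) • v :=
    mem_weightSubmodule.1 hv (coroot i j)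
  set e := LieModule.toEnd ℂ 𝔤 V (SpecialLinear.single i j h 1) with he
  have hex : ∃ k, (e ^ k) v = 0 := by
    obtain ⟨k, hk⟩ := isNilpotent_toEnd_single V i j h 1
    exact ⟨k, by rw [he, hk]; rfl⟩
  obtain ⟨n, hn, hn'⟩ := Nat.exists_not_and_succ_of_not_zero_of_exists (p := fun k => (e ^ k) v = 0)
    hv0 hex
  have P : t.HasPrimitiveVectorWith ((e ^ n) v) (ν (coroot i j) + 2 * n) :=
    { ne_zero := hn
      lie_h := t.lie_h_pow_toEnd_e hh n
      lie_e := by rw [IsSl2Triple.lie_e_pow_toEnd_e (R := ℂ)]; exact hn' }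
  obtain ⟨m, hm⟩ := P.exists_nat
  refine ⟨m - 2 * n, ?_⟩
  push_cast
  linear_combination hm

/-- A lift of the permutation matrix of `σ` maps the weight space of `l₁ ε_i - l₂ ε_j` into that of
`l₁ ε_{σ i} - l₂ ε_{σ j}`. -/
theorem finrank_weightSubmodule_le [FiniteDimensional ℂ V] (l : ℕ × ℕ) (i j : Fin 3)
    (σ : Equiv.Perm (Fin 3)) : Module.finrank ℂ (weightSubmodule V (orbitWeight l i j)) ≤
      Module.finrank ℂ (weightSubmodule V (orbitWeight l (σ i) (σ j))) := by
  set P : Matrix (Fin 3) (Fin 3) ℂ := σ⁻¹.permMatrix ℂ with hP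
  have hdet : P.det ≠ 0 := by
    rw [hP, Matrix.det_permutation]
    simp
  obtain ⟨A, hA⟩ := exists_equiv_of_det_ne_zero (V := V) P hdet
  have hmap : (weightSubmodule V (orbitWeight l i j)).map A.toLinearMap ≤
      weightSubmodule V (orbitWeight l (σ i) (σ j)) := by
    rintro _ ⟨v, hv, rfl⟩
    rw [mem_weightSubmodule]
    intro D
    let D' : 𝔥 := ⟨⟨Matrix.diagonal fun k => D.val.val (σ k) (σ k), by
      change Matrix.trace (Matrix.diagonal fun k => D.val.val (σ k) (σ k)) = 0
      have h : Matrix.trace D.val.val = 0 := D.val.property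
      rw [Matrix.trace_diagonal, ← h, Matrix.trace]
      exact Equiv.sum_comp σ fun k => D.val.val k k⟩, fun a b hab => Matrix.diagonal_apply_ne _ hab⟩
    have hD' (k : Fin 3) : D'.val.val k k = D.val.val (σ k) (σ k) := Matrix.diagonal_apply_eq _ k
    have hcomm : D.val.val * P = P * D'.val.val := by
      rw [cartan_eq_diagonal D]
      change _ = P * Matrix.diagonal _
      ext a b
      rw [Matrix.diagonal_mul, Matrix.mul_diagonal, hP]
      by_cases hab : σ⁻¹ a = b
      · subst hab; simp [mul_comm]
      · have hab' : Equiv.symm σ a ≠ b := hab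
        simp [Equiv.Perm.permMatrix, PEquiv.toMatrix_apply, hab']
    change ⁅D.val, A v⁆ = _ • A v
    rw [hA D' D.val hcomm, mem_weightSubmodule.1 hv D', map_smul, orbitWeight_apply,
      orbitWeight_apply, hD', hD']
  rw [← LinearEquiv.finrank_map_eq A]
  exact Submodule.finrank_mono hmap

theorem multiplicity_orbitWeight [FiniteDimensional ℂ V] (l : ℕ × ℕ) {i j : Fin 3} (h : i ≠ j) :
    multiplicity V (orbitWeight l i j) = multiplicity V (domWeight l) := by
  obtain ⟨σ, rfl, rfl⟩ : ∃ σ : Equiv.Perm (Fin 3), σ 0 = i ∧ σ 2 = j := by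
    revert i j; decide
  rw [multiplicity_eq, multiplicity_eq, domWeight_eq]
  refine le_antisymm ?_ (finrank_weightSubmodule_le l 0 2 σ)
  have := finrank_weightSubmodule_le (V := V) l (σ 0) (σ 2) σ⁻¹
  have h0 (k : Fin 3) : σ⁻¹ (σ k) = k := σ.symm_apply_apply k
  rwa [h0, h0] at this

theorem multiplicity_eq_of_mem_weylOrbit [FiniteDimensional ℂ V] {l : ℕ × ℕ}
    {ν : Module.Dual ℂ 𝔥} (h : ν ∈ weylOrbit l) :
    multiplicity V ν = multiplicity V (domWeight l) := by
  obtain ⟨i, j, hij, rfl⟩ := mem_weylOrbit_iff.1 h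
  exact multiplicity_orbitWeight l hij

theorem weightSubmodule_ne_bot_iff [FiniteDimensional ℂ V] {l : ℕ × ℕ} {ν : Module.Dual ℂ 𝔥}
    (h : ν ∈ weylOrbit l) : weightSubmodule V ν ≠ ⊥ ↔ l ∈ dominantWeights V := by
  rw [mem_dominantWeights, ← Submodule.finrank_eq_zero.ne, ← Submodule.finrank_eq_zero.ne,
    ← multiplicity_eq, ← multiplicity_eq, multiplicity_eq_of_mem_weylOrbit h]

/-- An integral weight is conjugate to a dominant one. -/
theorem exists_mem_weylOrbit {ν : Module.Dual ℂ 𝔥} {m n : ℤ} (hm : ν (coroot 0 1) = m)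
    (hn : ν (coroot 1 2) = n) : ∃ l, ν ∈ weylOrbit l := by
  have hν (D : 𝔥) : ν D = m * D.val.val 0 0 - n * D.val.val 2 2 := by
    have hD : D = D.val.val 0 0 • coroot 0 1 + (-D.val.val 2 2) • coroot 1 2 := by
      have h := trace_cartan D
      apply Subtype.ext
      apply Subtype.ext
      refine (cartan_eq_diagonal D).trans ?_
      change _ = D.val.val 0 0 • (coroot 0 1).val.val + (-D.val.val 2 2) • (coroot 1 2).val.val
      rw [val_coroot, val_coroot]
      ext a b
      fin_cases a <;> fin_cases b <;> simp
      linear_combination h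
    conv_lhs => rw [hD]
    rw [map_add, map_smul, map_smul, hm, hn, smul_eq_mul, smul_eq_mul]
    ring
  -- It suffices to sort the coordinates of `ν = (m + n) ε₀ + n ε₁ + 0 ε₂`.
  have key (i j : Fin 3) (hij : i ≠ j) (a b : ℤ) (ha : 0 ≤ a) (hb : 0 ≤ b)
      (h : ∀ D : 𝔥, (m * D.val.val 0 0 - n * D.val.val 2 2 : ℂ) =
        a * D.val.val i i - b * D.val.val j j) : ∃ l, ν ∈ weylOrbit l := by
    refine ⟨(a.toNat, b.toNat), mem_weylOrbit_iff.2 ⟨i, j, hij, LinearMap.ext fun D => ?_⟩⟩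
    rw [orbitWeight_apply, hν, h]
    have ha' : (a.toNat : ℂ) = a := by
      exact_mod_cast congrArg (Int.cast (R := ℂ)) (Int.toNat_of_nonneg ha)
    have hb' : (b.toNat : ℂ) = b := by
      exact_mod_cast congrArg (Int.cast (R := ℂ)) (Int.toNat_of_nonneg hb)
    rw [ha', hb']
  rcases le_total 0 m with h1 | h1 <;> rcases le_total 0 n with h2 | h2
  · exact key 0 2 (by decide) m n h1 h2 fun D => rfl
  · rcases le_total 0 (m + n) with h3 | h3
    · refine key 0 1 (by decide) (m + n) (-n) h3 (by omega) fun D => ?_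
      push_cast
      linear_combination -(n : ℂ) * trace_cartan D
    · refine key 2 1 (by decide) (-m - n) m (by omega) h1 fun D => ?_
      push_cast
      linear_combination (m : ℂ) * trace_cartan D
  · rcases le_total 0 (m + n) with h3 | h3
    · refine key 1 2 (by decide) (-m) (m + n) (by omega) h3 fun D => ?_
      push_cast
      linear_combination (m : ℂ) * trace_cartan D
    · refine key 1 0 (by decide) n (-m - n) h2 (by omega) fun D => ?_
      push_cast
      linear_combination -(n : ℂ) * trace_cartan D
  · refine key 2 0 (by decide) (-n) (-m) (by omega) (by omega) fun D => ?_
    push_cast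
    ring

/-! ### The determinant on the Cartan subalgebra -/

theorem finite_dominantWeights [FiniteDimensional ℂ V] : (dominantWeights V).Finite := by
  have hinj : Function.Injective domWeight := fun l l' h =>
    eq_of_domWeight_eq_orbitWeight (i := 0) (j := 2) (by decide) (h.trans (domWeight_eq l'))
  refine ((finite_weights V).preimage hinj.injOn).subset fun l hl => ?_
  exact mem_dominantWeights.1 hl

theorem det_smul_one_add_cartan [FiniteDimensional ℂ V] [LieModule.IsIrreducible ℂ 𝔤 V]
    (t : ℂ) (D : 𝔥) : LinearMap.det (t • 1 + LieModule.toEnd ℂ 𝔤 V D.val) =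
      ∏ ν ∈ (finite_weights V).toFinset, (t + ν D) ^ multiplicity V ν := by
  classical
  have hint : DirectSum.IsInternal fun ν : {ν // weightSubmodule V ν ≠ ⊥} => weightSubmodule V ν :=
    DirectSum.isInternal_ne_bot_iff.2 (DirectSum.isInternal_submodule_of_iSupIndep_of_iSup_eq_top
      (iSupIndep_weightSubmodule V) (iSup_weightSubmodule V))
  have : Finite {ν // weightSubmodule V ν ≠ ⊥} := finite_weights V
  have := Fintype.ofFinite {ν // weightSubmodule V ν ≠ ⊥}
  let B := hint.collectedBasis fun ν => Module.finBasis ℂ (weightSubmodule V ν)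
  have hB (a) : ⁅D.val, B a⁆ = a.1.val D • B a :=
    mem_weightSubmodule.1 (hint.collectedBasis_mem _ a) D
  have hmat : LinearMap.toMatrix B B (t • 1 + LieModule.toEnd ℂ 𝔤 V D.val) =
      Matrix.diagonal fun a => t + a.1.val D := by
    ext a c
    rw [LinearMap.toMatrix_apply]
    simp only [LinearMap.add_apply, LinearMap.smul_apply, Module.End.one_apply,
      LieModule.toEnd_apply_apply, hB]
    rw [← add_smul, map_smul, Module.Basis.repr_self, Matrix.diagonal_apply]
    by_cases h : a = c
    · subst h; simp
    · simp [h]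
  rw [← LinearMap.det_toMatrix B, hmat, Matrix.det_diagonal, Fintype.prod_sigma]
  simp only [Finset.prod_const, Finset.card_univ, Fintype.card_fin]
  exact (Finset.prod_subtype (finite_weights V).toFinset (fun ν => by simp)
    fun ν => (t + ν D) ^ multiplicity V ν).symm

/-- The set of weights is the disjoint union of the orbits of the dominant weights, and
multiplicities are constant on orbits. -/
theorem det_smul_one_add_cartan_eq_prod_orbits [FiniteDimensional ℂ V]
    [LieModule.IsIrreducible ℂ 𝔤 V] (t : ℂ) (D : 𝔥) :
    LinearMap.det (t • 1 + LieModule.toEnd ℂ 𝔤 V D.val) =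
      ∏ l ∈ (finite_dominantWeights (V := V)).toFinset,
        (∏ᶠ ν ∈ weylOrbit l, (t + ν D)) ^ multiplicity V (domWeight l) := by
  classical
  have hS : (finite_weights V).toFinset = (finite_dominantWeights (V := V)).toFinset.biUnion
      fun l => (weylOrbit_finite l).toFinset := by
    ext ν
    simp only [Set.Finite.mem_toFinset, Set.mem_ofPred_eq, Finset.mem_biUnion]
    constructor
    · intro h
      obtain ⟨m, hm⟩ := exists_int_coroot h 0 1 (by decide)
      obtain ⟨n, hn⟩ := exists_int_coroot h 1 2 (by decide)
      obtain ⟨l, hl⟩ := exists_mem_weylOrbit hm hn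
      exact ⟨l, (weightSubmodule_ne_bot_iff hl).1 h, hl⟩
    · rintro ⟨l, hl, hν⟩
      exact (weightSubmodule_ne_bot_iff hν).2 hl
  rw [det_smul_one_add_cartan, hS, Finset.prod_biUnion]
  · refine Finset.prod_congr rfl fun l _ => ?_
    rw [finprod_mem_eq_finite_toFinset_prod _ (weylOrbit_finite l), ← Finset.prod_pow]
    refine Finset.prod_congr rfl fun ν hν => ?_
    rw [multiplicity_eq_of_mem_weylOrbit ((weylOrbit_finite l).mem_toFinset.1 hν)]
  · intro l _ l' _ hne
    rw [Function.onFun, Finset.disjoint_left]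
    intro ν h h'
    rw [Set.Finite.mem_toFinset] at h h'
    apply hne
    have heq : weylOrbit l = weylOrbit l' := by
      rw [weylOrbit, weylOrbit, MulAction.orbit_eq_iff.2 h |>.symm, MulAction.orbit_eq_iff.2 h']
    have hl : domWeight l ∈ weylOrbit l' := heq ▸ MulAction.mem_orbit_self _
    obtain ⟨i, j, hij, hl⟩ := mem_weylOrbit_iff.1 hl
    exact eq_of_domWeight_eq_orbitWeight hij hl

end Weights

/-! ### Reduction to diagonal matrices -/

/-- The discriminant of the characteristic polynomial of the generic matrix. -/
def disc : PolyRing := -4 * p ^ 3 - 27 * q ^ 2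

theorem disc_ne_zero : disc ≠ 0 := by
  intro h
  have := congrArg (eval fun k => if k = some (.inl 0) then (1 : ℂ) else 0) h
  simp [disc, p, q_eq, zH, zE] at this

/-- Where the discriminant does not vanish, the matrix has three distinct eigenvalues, and the
matrix `P` of eigenvectors diagonalizes it. -/
theorem exists_diagonalization (z : Option BasisIndex → ℂ) (hz : eval z disc ≠ 0) :
    ∃ (D : 𝔥) (P : Matrix (Fin 3) (Fin 3) ℂ), P.det ≠ 0 ∧
      (specialL z).val * P = P * D.val.val ∧
      (specialL z).val.charpoly = D.val.val.charpoly := by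
  set A := (specialL z).val with hA
  have hsplit := IsAlgClosed.splits A.charpoly
  have hcard : A.charpoly.roots.card = 3 := by
    rw [← hsplit.natDegree_eq_card_roots, Matrix.charpoly_natDegree_eq_dim]; simp
  obtain ⟨a, b, c, habc⟩ := Multiset.card_eq_three.1 hcard
  have hchar : A.charpoly = ∏ i : Fin 3, (Polynomial.X - Polynomial.C (![a, b, c] i)) := by
    have := hsplit.eq_prod_roots_of_monic A.charpoly_monic
    rw [habc] at this
    rw [this, Fin.prod_univ_three]
    simp [mul_assoc]
  have heval (t : ℂ) : t ^ 3 + eval z p * t - eval z q = (t - a) * (t - b) * (t - c) := by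
    rw [← charpoly_specialL, ← hA, hchar, Fin.prod_univ_three]
    simp
  have h0 := heval 0
  have h1 := heval 1
  have h2 := heval (-1)
  have hsum : a + b + c = 0 := by linear_combination (h1 + h2 - 2 * h0) / 2
  have hc : c = -a - b := by linear_combination hsum
  have hq : eval z q = a * b * c := by linear_combination -h0
  have hp : eval z p = a * b + b * c + a * c := by linear_combination (h1 - h2) / 2
  have hdisc : eval z disc = ((a - b) * (b - c) * (a - c)) ^ 2 := by
    simp only [disc, map_sub, map_mul, map_neg, map_pow, map_ofNat, hp, hq, hc]
    ring
  rw [hdisc] at hz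
  have hz := ne_zero_pow two_ne_zero hz
  obtain ⟨⟨hab, hbc⟩, hac⟩ : (a - b ≠ 0 ∧ b - c ≠ 0) ∧ a - c ≠ 0 := by
    simpa [mul_ne_zero_iff] using hz
  rw [sub_ne_zero] at hab hbc hac
  have hinj : Function.Injective ![a, b, c] := by
    intro i j hij
    fin_cases i <;> fin_cases j <;> simp_all
  have hev (i : Fin 3) : ∃ v : Fin 3 → ℂ, Module.End.HasEigenvector (Matrix.toLin' A)
      (![a, b, c] i) v := by
    have : Module.End.HasEigenvalue (Matrix.toLin' A) (![a, b, c] i) := by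
      rw [Module.End.hasEigenvalue_iff_isRoot_charpoly, Matrix.charpoly_toLin', hchar,
        Polynomial.IsRoot, Polynomial.eval_prod]
      exact Finset.prod_eq_zero (Finset.mem_univ i) (by simp)
    exact this.exists_hasEigenvector
  choose v hv using hev
  have hli := Module.End.eigenvectors_linearIndependent' (Matrix.toLin' A) ![a, b, c] hinj v hv
  let P : Matrix (Fin 3) (Fin 3) ℂ := (Matrix.of v).transpose
  let D : 𝔥 := ⟨⟨Matrix.diagonal ![a, b, c], by
    change Matrix.trace (Matrix.diagonal ![a, b, c]) = 0
    rw [Matrix.trace_diagonal, Fin.sum_univ_three]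
    simpa using hsum⟩, fun i j hij => Matrix.diagonal_apply_ne _ hij⟩
  refine ⟨D, P, ?_, ?_, ?_⟩
  · have hPu : IsUnit P := Matrix.linearIndependent_cols_iff_isUnit.1 hli
    exact ((Matrix.isUnit_iff_isUnit_det _).1 hPu).ne_zero
  · change A * P = P * Matrix.diagonal ![a, b, c]
    ext i j
    have := congrFun (hv j).apply_eq_smul i
    rw [Matrix.toLin'_apply] at this
    rw [Matrix.mul_diagonal]
    change A.mulVec (v j) i = v j i * _
    rw [this, Pi.smul_apply, smul_eq_mul, mul_comm]
  · change A.charpoly = (Matrix.diagonal ![a, b, c]).charpoly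
    rw [hchar, Matrix.charpoly_diagonal]

section Factorization

variable {V : Type*} [AddCommGroup V] [Module ℂ V] [LieRingModule 𝔤 V] [LieModule ℂ 𝔤 V]

theorem eval_charPoly {ι : Type*} [Fintype ι] [DecidableEq ι] (b : Module.Basis ι ℂ V)
    (z : Option BasisIndex → ℂ) : eval z (charPoly b) =
      LinearMap.det (z none • 1 + LieModule.toEnd ℂ 𝔤 V (specialL z)) := by
  rw [← LinearMap.det_toMatrix b, charPoly, RingHom.map_det]
  congr 1
  ext i j
  simp only [specialL, map_add, map_sum, map_smul, LinearMap.toMatrix_one, RingHom.mapMatrix_apply,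
    Matrix.map_apply, Matrix.add_apply, Matrix.sum_apply, Matrix.smul_apply, smul_eq_mul, map_mul,
    eval_X, eval_C, z₀]
  congr 2
  by_cases h : i = j <;> simp [Matrix.one_apply, h]

/-- Both sides agree wherever the discriminant does not vanish, hence everywhere. -/
theorem charPoly_eq_prod [FiniteDimensional ℂ V] [LieModule.IsIrreducible ℂ 𝔤 V] {ι : Type*}
    [Fintype ι] [DecidableEq ι] (b : Module.Basis ι ℂ V) :
    charPoly b = ∏ l ∈ (finite_dominantWeights (V := V)).toFinset,
      orbitalFactor l ^ multiplicity V (domWeight l) := by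
  refine sub_eq_zero.1 ((mul_eq_zero.1 (?_ : disc * _ = 0)).resolve_left disc_ne_zero)
  refine MvPolynomial.funext fun z => ?_
  rw [map_mul, map_zero]
  by_cases hz : eval z disc = 0
  · rw [hz, zero_mul]
  obtain ⟨D, P, hP, hLP, hchar⟩ := exists_diagonalization z hz
  obtain ⟨A, hA⟩ := exists_equiv_of_det_ne_zero (V := V) P hP
  have hconj : z none • 1 + LieModule.toEnd ℂ 𝔤 V (specialL z) =
      (A : V →ₗ[ℂ] V) ∘ₗ (z none • 1 + LieModule.toEnd ℂ 𝔤 V D.val) ∘ₗ (A.symm : V →ₗ[ℂ] V) := by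
    ext v
    have := hA D (specialL z) hLP (A.symm v)
    rw [LinearEquiv.apply_symm_apply] at this
    simp [this]
  rw [map_sub, eval_charPoly, hconj, LinearMap.det_conj, det_smul_one_add_cartan_eq_prod_orbits,
    map_prod]
  simp only [map_pow, eval_orbitalFactor _ z D hchar, sub_self, mul_zero]

end Factorization

end

end SL3

theorem theorem1 (V : Type*) [AddCommGroup V] [Module ℂ V] [LieRingModule SL3.𝔤 V]
    [LieModule ℂ SL3.𝔤 V] [FiniteDimensional ℂ V] [LieModule.IsIrreducible ℂ SL3.𝔤 V]
    {ι : Type*} [Fintype ι] [DecidableEq ι] (b : Module.Basis ι ℂ V) :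
    -- the factorization, over the finitely many dominant weights of `V`
    (∃ hfin : (SL3.dominantWeights V).Finite,
      SL3.charPoly b = ∏ l ∈ hfin.toFinset,
        SL3.orbitalFactor l ^ SL3.multiplicity V (SL3.domWeight l)) ∧
    -- the polynomials `p` and `q` from which the factors are built
    Matrix.det (SL3.z₀ • (1 : Matrix (Fin 3) (Fin 3) SL3.PolyRing) - SL3.genericL) =
      SL3.z₀ ^ 3 + SL3.p * SL3.z₀ - SL3.q ∧
    -- each factor is irreducible, of degree the size of the orbit, and comes from the orbit
    ∀ l : ℕ × ℕ,
      Irreducible (SL3.orbitalFactor l) ∧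
      (SL3.orbitalFactor l).totalDegree = (SL3.weylOrbit l).ncard ∧
      (SL3.orbitalFactor l).degreeOf none = (SL3.weylOrbit l).ncard ∧
      (SL3.weylOrbit l).ncard ∈ ({1, 3, 6} : Set ℕ) ∧
      ∀ (z : Option SL3.BasisIndex → ℂ) (D : SL3.𝔥),
        (SL3.specialL z).val.charpoly = D.val.val.charpoly →
          MvPolynomial.eval z (SL3.orbitalFactor l) =
            ∏ᶠ ν ∈ SL3.weylOrbit l, (z none + ν D) := by
  refine ⟨⟨SL3.finite_dominantWeights, SL3.charPoly_eq_prod b⟩, SL3.det_sub_genericL, fun l => ?_⟩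
  obtain ⟨h1, h2, h3, h4⟩ := SL3.orbitalFactor_properties l
  exact ⟨h1, h2, h3, h4, SL3.eval_orbitalFactor l⟩
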